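/- Let $e=e_1\in\mathbb R^3$ and $r>0$. For $(u,h,v)\in S^2\times\mathbb R^+\times S^2$ (with $u\ne e$, $u\neq v$) consider two fixed spherical scatterers of radius $r$, possibly overlapping, with centres $$a=r\frac{e-u}{|e-u|},\qquad b=hu+r\frac{u-v}{|u-v|}.$$ A point particle with incoming velocity $w_0=e$ collides with the first scatterer at time $\tau_1=0$ at the origin, leaves with velocity $w_1=u$, collides with the second scatterer at time $\tau_2=h$ at the point $hu$, leaves with velocity $w_2=v$, and from then on moves with unit speed, with free flights and elastic reflections at the two balls $B_r(a)$, $B_r(b)$. Let $N=N_r(u,h,v)$ be the total number of collisions, $\tilde\beta_r=\tau_N$ the time of the last collision, and $\tilde w_r=w_N$ the outgoing velocity (if $N=\infty$, $\tilde\beta_r$ is the supremum of the collision times and there is no outgoing velocity, so that such points belong to no event about $\tilde w_r$). Let $$\tilde A_r=\Bigl\{(u,h,v): h>0,\ \exists\, t>0:\ \Bigl|hu+r\frac{u-e}{|u-e|}+tv\Bigr|<r\Bigr\}$$ be the set of recollision events, in which the particle returns to the first scatterer directly after the second collision. Let $\mu=\mathrm{Uni}(S^2)\times \mathrm{Exp}(1|1)\times\mathrm{Uni}(S^2)$,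 where $\mathrm{Exp}(1|1)$ is the unit exponential law conditioned to $[0,1]$, with density $\mathbf 1_{[0,1]}(x)\,e^{1-x}/(e-1)$. Then there is a constant $C\in(0,\infty)$, independent of $r$ and $s$, such that for all $r>0$ and $s>0$ $$\begin{aligned} \mu\bigl((u,h,v)\in\tilde A_r:\ \angle(-e,\tilde w_r)<s^{-1},\ h\le 10r\bigr)&\le \frac{Cr}{1+s},\\ \mu\bigl((u,h,v)\in\tilde A_r:\ \angle(-e,\tilde w_r)<s^{-1},\ h\ge 10r,\ N=3\bigr)&\le \frac{Cr}{1+s},\\ \mu\bigl((u,h,v)\in\tilde A_r:\ \angle(-e,\tilde w_r)<s^{-1},\ h\ge 10r,\ N\ge4\bigr)&\le \frac{Cr}{(1+s)^2},\\ \mu\bigl((u,h,v)\in\tilde A_r:\ r^{-1}\tilde\beta_r>s,\ N=3\bigr)&\le \frac{Cr}{1+s},\\ \mu\bigl((u,h,v)\in\tilde A_r:\ r^{-1}\tilde\beta_r>s,\ N\ge4\bigr)&\le \frac{Cr}{1+s^2}, \end{aligned}$$ and, with the same $C$, for all $0<r\le1$ and $s>0$, also for the unscaled trapping time, $$\mu\bigl((u,h,v)\in\tilde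 A_r:\ \tilde\beta_r>s,\ N=3\bigr)\le \frac{Cr}{1+s},\qquad \mu\bigl((u,h,v)\in\tilde A_r:\ \tilde\beta_r>s,\ N\ge4\bigr)\le \frac{Cr}{1+s^2}.$$ -/

import Mathlib

open MeasureTheory

noncomputable section

namespace Lorentz

/-- Euclidean three-space. -/
abbrev E3 : Type := EuclideanSpace ℝ (Fin 3)

/-- The unit sphere of velocities. -/
abbrev S2 : Type := Metric.sphere (0 : E3) 1

/-- The incoming velocity `e`, the first coordinate vector. -/
def e : E3 := EuclideanSpace.single 0 1

/-- Centre of the first scatterer: the velocity turns from `e` to `u` at the origin. -/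
def centerA (r : ℝ) (u : E3) : E3 := r • (‖e - u‖⁻¹ • (e - u))

/-- Centre of the second scatterer: the velocity turns from `u` to `v` at the point `ξ u`. -/
def centerB (r : ℝ) (u : E3) (ξ : ℝ) (v : E3) : E3 := ξ • u + r • (‖u - v‖⁻¹ • (u - v))

/-- A collision time, the position of the particle at that time, and its velocity just after. -/
structure State where
  time : ℝ
  pos : E3
  vel : E3

/-- The times at which the free flight from `x` with velocity `w` is inside the scatterer of
radius `r` centred at `c`. -/
def insideTimes (r : ℝ) (c x w : E3) : Set ℝ := {t : ℝ | 0 < t ∧ ‖x + t • w - c‖ < r}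

/-- The free flight from `x` with velocity `w` runs into the scatterer centred at `c`. -/
def Hits (r : ℝ) (c x w : E3) : Prop := (insideTimes r c x w).Nonempty

/-- The flight time to the scatterer centred at `c` (meaningful if it is hit). -/
def hitTime (r : ℝ) (c x w : E3) : ℝ := sInf (insideTimes r c x w)

/-- Elastic reflection of the velocity `w` at the point `x` of the sphere of radius `r`
about `c`. -/
def reflect (r : ℝ) (c x w : E3) : E3 :=
  w - (2 * inner ℝ w (r⁻¹ • (x - c))) • (r⁻¹ • (x - c))

/-- Free flight to the scatterer centred at `c`, followed by an elastic collision with it. -/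
def collide (r : ℝ) (c : E3) (σ : State) : State where
  time := σ.time + hitTime r c σ.pos σ.vel
  pos := σ.pos + hitTime r c σ.pos σ.vel • σ.vel
  vel := reflect r c (σ.pos + hitTime r c σ.pos σ.vel • σ.vel) σ.vel

open Classical in
/-- The next collision with one of the two scatterers centred at `a` and `b`, namely the one which
is reached first; `none` if the particle escapes. -/
def nextCollision (r : ℝ) (a b : E3) (σ : State) : Option State :=
  if Hits r a σ.pos σ.vel ∧
      (Hits r b σ.pos σ.vel → hitTime r a σ.pos σ.vel ≤ hitTime r b σ.pos σ.vel) then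
    some (collide r a σ)
  else if Hits r b σ.pos σ.vel then some (collide r b σ)
  else none

/-- The state after the `k`-th collision, `none` if there are fewer than `k` collisions.
Index `0` stands for the incoming velocity `w₀ = e`. The first two collisions, at times `0` and `ξ`,
are prescribed by `(u, ξ, v)`; the later ones follow from the dynamics. -/
def afterCollision (r : ℝ) (u : E3) (ξ : ℝ) (v : E3) : ℕ → Option State
  | 0 => some ⟨0, 0, e⟩
  | 1 => some ⟨0, 0, u⟩
  | 2 => some ⟨ξ, ξ • u, v⟩
  | (k + 3) => (afterCollision r u ξ v (k + 2)).bind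
      (nextCollision r (centerA r u) (centerB r u ξ v))

/-- The total number `N` of collisions (possibly infinite). -/
def numCollisions (r : ℝ) (p : S2 × ℝ × S2) : ℕ∞ :=
  ⨆ (k : ℕ) (_ : (afterCollision r p.1 p.2.1 p.2.2 k).isSome), (k : ℕ∞)

/-- The time of the last collision. The collision times are nondecreasing, so it is their
supremum; the supremum also makes sense if there are infinitely many collisions. -/
def trappingTime (r : ℝ) (p : S2 × ℝ × S2) : EReal :=
  ⨆ (k : ℕ) (σ : State) (_ : afterCollision r p.1 p.2.1 p.2.2 k = some σ), (σ.time : EReal)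

/-- `w` is the outgoing velocity, i.e. the velocity after the last collision. -/
def IsExitVelocity (r : ℝ) (p : S2 × ℝ × S2) (w : E3) : Prop :=
  ∃ (n : ℕ) (σ : State), numCollisions r p = n ∧
    afterCollision r p.1 p.2.1 p.2.2 n = some σ ∧ σ.vel = w

/-- The set of recollision events: after the second collision, at `ξ u`, the particle flies with
velocity `v` back into the first scatterer. -/
def recollisionSet (r : ℝ) : Set (S2 × ℝ × S2) :=
  {p | 0 < p.2.1 ∧ ∃ t : ℝ, 0 < t ∧
    ‖p.2.1 • (p.1 : E3) + r • (‖(p.1 : E3) - e‖⁻¹ • ((p.1 : E3) - e)) + t • (p.2.2 : E3)‖ < r}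

/-- The angle between `-e` and the outgoing velocity is less than `δ`. -/
def ExitAngleLT (r : ℝ) (p : S2 × ℝ × S2) (δ : ℝ) : Prop :=
  ∃ w : E3, IsExitVelocity r p w ∧ InnerProductGeometry.angle (-e) w < δ

/-- The uniform probability measure on the unit sphere. -/
def uniS2 : Measure S2 :=
  ((volume : Measure E3).toSphere Set.univ)⁻¹ • (volume : Measure E3).toSphere

/-- The unit exponential distribution conditioned to `[0,1]`, by its density. -/
def expCond : Measure ℝ :=
  volume.withDensity fun x : ℝ =>
    ENNReal.ofReal ((Set.Icc (0 : ℝ) 1).indicator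
      (fun y => Real.exp (1 - y) / (Real.exp 1 - 1)) x)

/-- The law `Uni(S²) × Exp(1|1) × Uni(S²)` of `(u, ξ, v)`. -/
def mu : Measure (S2 × ℝ × S2) := uniS2.prod (expCond.prod uniS2)

end Lorentz

end

namespace Lorentz

open scoped Pointwise

/-! Rescaling by r reduces everything to unit scatterers with free flight ξ = h/r, whose law has
density at most 2r. By `mu_le_of_slices` it suffices to bound, for fixed u and ξ, the uniform
measure of the admissible v by some g(ξ), and to integrate g over ξ > 0. Balls are convex, so
collisions alternate and the orbit is an explicit measurable function of the data
(`tracks_afterCollision`).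

Two instabilities supply g. The first is transverse. Let m be a unit vector orthogonal to e and u,
with v·m ≥ 0. Both centres then have nonpositive m-component, so reflections only push the particle
further along m, and x·m and w·m never decrease (`transverse_mono`). Hence |v·m| ≤ |w_n + e|: an
exit direction within δ of -e confines v to a strip of width O(δ), which settles h ≤ 10r. Moreover,
a particle trapped in a region of size ξ + 4 keeps turning, so x·m + w·m grows by a factor 3/2 per
time window 3(ξ + 4) while staying at most 2 (`growth_pow`); thus |v·m| decays exponentially in s/ξ.

The second concerns distant scatterers, ξ ≥ 10. Hitting the first ball again costs O(ξ⁻²). Orbits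
with the same u and ξ separate by a factor 3 per collision, after an initial gain of order ξ
(`separation`), whereas two orbits leaving within δ of -e and passing the last ball on the same side
have last incoming velocities within 45δ (`vel_close`). For N = 3 that velocity is v, so the slice
is O(min(ξ⁻², δ²)), with integral O(δ). For N = n + 4 the slice has two pieces of diameter
O(3⁻ⁿδ/ξ); squaring, summing over n and integrating gives O(δ²).

For the trapping time with N = 3, the last collision happens by time 2ξ + 4, so only ξ of order at
least s contributes, and the integral of ξ⁻² is O(1/s). With N ≥ 4, the first two long flights
improve the bound on |v·m| by ξ⁻², and the component of v orthogonal to u and m is O(ξ⁻¹); the slice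
O(ξ/(ξ² + s²)²) integrates to O(s⁻²). -/

theorem norm_e : ‖e‖ = 1 := by simp [e]

/-! ### Unit vectors, centres and specular reflection -/

theorem norm_inv_norm_smul {x : E3} (hx : x ≠ 0) : ‖‖x‖⁻¹ • x‖ = 1 := by
  rw [norm_smul, norm_inv, norm_norm, inv_mul_cancel₀ (norm_ne_zero_iff.2 hx)]

theorem norm_centerA {u : E3} (hu : u ≠ e) : ‖centerA 1 u‖ = 1 := by
  rw [centerA, one_smul]; exact norm_inv_norm_smul (sub_ne_zero.2 hu.symm)

theorem norm_centerB_sub {u v : E3} {ξ : ℝ} (huv : u ≠ v) : ‖centerB 1 u ξ v - ξ • u‖ = 1 := by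
  rw [centerB, one_smul, add_sub_cancel_left]; exact norm_inv_norm_smul (sub_ne_zero.2 huv)

theorem inner_centerA_of_orthogonal {u m : E3} {r : ℝ} (hu : inner ℝ u m = 0)
    (he : inner ℝ e m = 0) : inner ℝ (centerA r u) m = 0 := by
  simp [centerA, inner_smul_left, inner_sub_left, hu, he]

theorem inner_centerB_of_orthogonal {u v m : E3} {ξ : ℝ} (hu : inner ℝ u m = 0) :
    inner ℝ (centerB 1 u ξ v) m = -(‖u - v‖⁻¹ * inner ℝ v m) := by
  simp [centerB, inner_smul_left, inner_sub_left, inner_add_left, hu]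

theorem abs_inner_le_of_norm_eq_one {x m : E3} (hm : ‖m‖ = 1) : |inner ℝ x m| ≤ ‖x‖ := by
  simpa [hm] using abs_real_inner_le_norm x m

/-- Specular reflection at a unit normal. -/
theorem norm_sub_reflection {w n : E3} (hn : ‖n‖ = 1) :
    ‖w - (2 * inner ℝ w n) • n‖ = ‖w‖ := by
  have h : ‖w - (2 * inner ℝ w n) • n‖ ^ 2 = ‖w‖ ^ 2 := by
    rw [norm_sub_sq_real, norm_smul, inner_smul_right, hn, Real.norm_eq_abs, mul_one, sq_abs]
    ring
  exact (sq_eq_sq₀ (norm_nonneg _) (norm_nonneg _)).1 h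

/-- The squared right-hand norm is (f - g)² + 2fg(1 - x·y), and fg ≥ c². -/
theorem norm_smul_sub_smul_ge {x y : E3} {f g c : ℝ} (hx : ‖x‖ = 1) (hy : ‖y‖ = 1) (hc : 0 ≤ c)
    (hf : c ≤ f) (hg : c ≤ g) : c * ‖x - y‖ ≤ ‖f • x - g • y‖ := by
  refine le_of_sq_le_sq ?_ (norm_nonneg _)
  rw [mul_pow, norm_sub_sq_real, norm_sub_sq_real, norm_smul, norm_smul, inner_smul_left,
    inner_smul_right, hx, hy, Real.norm_eq_abs, Real.norm_eq_abs, mul_one, mul_one, sq_abs, sq_abs]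
  have h1 : inner ℝ x y ≤ 1 := by simpa [hx, hy] using real_inner_le_norm x y
  simp only [conj_trivial]
  have h2 : c * c ≤ f * g := mul_le_mul hf hg hc (hc.trans hf)
  nlinarith [sq_nonneg (f - g), mul_nonneg (sub_nonneg.2 h2) (sub_nonneg.2 h1)]

/-- Dispersion at a convex scatterer: if both velocity kicks have length at least c, different
normals force different kicks, hence different outgoing velocities unless the incoming ones already
differ. -/
theorem norm_reflection_sub_reflection_ge {w w' n n' : E3} {c : ℝ} (hn : ‖n‖ = 1) (hn' : ‖n'‖ = 1)
    (hc : 0 ≤ c) (hf : c ≤ -(2 * inner ℝ w n)) (hf' : c ≤ -(2 * inner ℝ w' n')) :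
    c * ‖n - n'‖ ≤
      ‖(w - (2 * inner ℝ w n) • n) - (w' - (2 * inner ℝ w' n') • n')‖ + ‖w - w'‖ := by
  have h := norm_smul_sub_smul_ge hn hn' hc hf hf'
  refine h.trans ?_
  have : (-(2 * inner ℝ w n)) • n - (-(2 * inner ℝ w' n')) • n' =
      ((w - (2 * inner ℝ w n) • n) - (w' - (2 * inner ℝ w' n') • n')) - (w - w') := by
    simp only [neg_smul]; abel
  rw [this]
  exact norm_sub_le _ _

/-- The centre of the scatterer met at the `j`-th collision after the two prescribed ones
(unit radius). -/
noncomputable def ctr (u : E3) (ξ : ℝ) (v : E3) (j : ℕ) : E3 :=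
  if Odd j then centerA 1 u else centerB 1 u ξ v

/-- `n` further collisions, alternately with the two scatterers of radius one, with flight times
`τ`, positions `x` and velocities `w`. -/
structure IsOrbit (u : E3) (ξ : ℝ) (v : E3) (n : ℕ) (τ : ℕ → ℝ) (x w : ℕ → E3) : Prop where
  pos_zero : x 0 = ξ • u
  vel_zero : w 0 = v
  flight : ∀ j < n, x (j + 1) = x j + τ j • w j
  time_nonneg : ∀ j < n, 0 ≤ τ j
  sphere : ∀ j < n, ‖x (j + 1) - ctr u ξ v (j + 1)‖ = 1
  incoming : ∀ j < n, inner ℝ (w j) (x (j + 1) - ctr u ξ v (j + 1)) ≤ 0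
  reflection : ∀ j < n, w (j + 1) = w j -
    (2 * inner ℝ (w j) (x (j + 1) - ctr u ξ v (j + 1))) • (x (j + 1) - ctr u ξ v (j + 1))

namespace IsOrbit

variable {u v : E3} {ξ : ℝ} {n : ℕ} {τ : ℕ → ℝ} {x w : ℕ → E3}

theorem norm_vel (h : IsOrbit u ξ v n τ x w) (hv : ‖v‖ = 1) {j : ℕ} (hj : j ≤ n) : ‖w j‖ = 1 := by
  induction j with
  | zero => rw [h.vel_zero, hv]
  | succ j ih =>
    rw [h.reflection j hj, norm_sub_reflection (h.sphere j hj), ih (by omega)]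

theorem norm_vel_sub (h : IsOrbit u ξ v n τ x w) {j : ℕ} (hj : j < n) :
    ‖w (j + 1) - w j‖ = -(2 * inner ℝ (w j) (x (j + 1) - ctr u ξ v (j + 1))) := by
  rw [h.reflection j hj, sub_sub_cancel_left, norm_neg, norm_smul, h.sphere j hj, mul_one,
    Real.norm_eq_abs, abs_of_nonpos]
  linarith [h.incoming j hj]

/-- The kick is a nonnegative multiple of the outward normal; this sign drives all the transverse
estimates. -/
theorem vel_succ (h : IsOrbit u ξ v n τ x w) {j : ℕ} (hj : j < n) :
    w (j + 1) = w j + ‖w (j + 1) - w j‖ • (x (j + 1) - ctr u ξ v (j + 1)) := by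
  rw [h.norm_vel_sub hj, neg_smul, ← sub_eq_add_neg]; exact h.reflection j hj

theorem norm_pos_sub (h : IsOrbit u ξ v n τ x w) (hv : ‖v‖ = 1) {j : ℕ} (hj : j < n) :
    ‖x (j + 1) - x j‖ = τ j := by
  rw [h.flight j hj, add_sub_cancel_left, norm_smul, h.norm_vel hv hj.le, mul_one,
    Real.norm_of_nonneg (h.time_nonneg j hj)]

/-- The first sphere passes through the origin and the second through ξ u, so each collision point
lies within one diameter of one of these two points. -/
theorem norm_pos_of_odd (h : IsOrbit u ξ v n τ x w) (hu : u ≠ e) {j : ℕ} (hj : j ≤ n)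
    (ho : Odd j) : ‖x j‖ ≤ 2 := by
  obtain ⟨i, rfl⟩ : ∃ i, j = i + 1 := ⟨j - 1, by have := ho.pos; omega⟩
  have h1 := h.sphere i hj
  rw [ctr, if_pos ho] at h1
  calc ‖x (i + 1)‖ = ‖(x (i + 1) - centerA 1 u) + centerA 1 u‖ := by rw [sub_add_cancel]
    _ ≤ 1 + 1 := (norm_add_le _ _).trans (by rw [h1, norm_centerA hu])
    _ = 2 := by norm_num

theorem norm_pos_of_even (h : IsOrbit u ξ v n τ x w) (huv : u ≠ v) {j : ℕ} (hj : j ≤ n)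
    (ho : Even j) : ‖x j - ξ • u‖ ≤ 2 := by
  rcases Nat.eq_zero_or_pos j with rfl | hp
  · simp [h.pos_zero]
  obtain ⟨i, rfl⟩ : ∃ i, j = i + 1 := ⟨j - 1, by omega⟩
  have h1 := h.sphere i hj
  rw [ctr, if_neg (Nat.not_odd_iff_even.2 ho)] at h1
  calc ‖x (i + 1) - ξ • u‖
      = ‖(x (i + 1) - centerB 1 u ξ v) + (centerB 1 u ξ v - ξ • u)‖ := by rw [sub_add_sub_cancel]
    _ ≤ 1 + 1 := (norm_add_le _ _).trans (by rw [h1, norm_centerB_sub huv])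
    _ = 2 := by norm_num

theorem norm_pos_sub_le (h : IsOrbit u ξ v n τ x w) (hu1 : ‖u‖ = 1) (hu : u ≠ e) (huv : u ≠ v)
    (hξ : 0 < ξ) {i j : ℕ} (hi : i ≤ n) (hj : j ≤ n) : ‖x i - x j‖ ≤ ξ + 4 := by
  have hξu : ‖ξ • u‖ = ξ := by rw [norm_smul, hu1, mul_one, Real.norm_of_nonneg hξ.le]
  rcases Nat.even_or_odd i with ei | oi <;> rcases Nat.even_or_odd j with ej | oj
  · have := norm_sub_le (x i - ξ • u) (x j - ξ • u)
    rw [sub_sub_sub_cancel_right] at this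
    linarith [h.norm_pos_of_even huv hi ei, h.norm_pos_of_even huv hj ej]
  · have h1 := norm_sub_le ((x i - ξ • u) + ξ • u) (x j)
    have h2 := norm_add_le (x i - ξ • u) (ξ • u)
    rw [sub_add_cancel] at h1 h2
    linarith [h.norm_pos_of_even huv hi ei, h.norm_pos_of_odd hu hj oj]
  · have h1 := norm_sub_le (x i) ((x j - ξ • u) + ξ • u)
    have h2 := norm_add_le (x j - ξ • u) (ξ • u)
    rw [sub_add_cancel] at h1 h2
    linarith [h.norm_pos_of_even huv hj ej, h.norm_pos_of_odd hu hi oi]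
  · linarith [norm_sub_le (x i) (x j), h.norm_pos_of_odd hu hi oi, h.norm_pos_of_odd hu hj oj]

/-! ### Motion transverse to the plane of the first collision -/

/-- The first centre lies in the plane of e and u, while the second is displaced from it along -v:
the centres sit on the side of the plane opposite to the motion. -/
theorem inner_ctr_nonpos {m : E3} (hum : inner ℝ u m = 0) (hem : inner ℝ e m = 0)
    (hvm : 0 ≤ inner ℝ v m) (j : ℕ) : inner ℝ (ctr u ξ v j) m ≤ 0 := by
  unfold ctr
  split_ifs
  · rw [inner_centerA_of_orthogonal hum hem]
  · rw [inner_centerB_of_orthogonal hum]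
    have : 0 ≤ ‖u - v‖⁻¹ * inner ℝ v m := by positivity
    linarith

theorem inner_pos_succ (h : IsOrbit u ξ v n τ x w) (m : E3) {j : ℕ} (hj : j < n) :
    inner ℝ (x (j + 1)) m = inner ℝ (x j) m + τ j * inner ℝ (w j) m := by
  rw [h.flight j hj, inner_add_left, inner_smul_left]; simp

theorem inner_vel_succ (h : IsOrbit u ξ v n τ x w) {m : E3} (hum : inner ℝ u m = 0)
    (hem : inner ℝ e m = 0) (hvm : 0 ≤ inner ℝ v m) {j : ℕ} (hj : j < n) :
    inner ℝ (w j) m + ‖w (j + 1) - w j‖ * inner ℝ (x (j + 1)) m ≤ inner ℝ (w (j + 1)) m := by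
  have h1 := congrArg (fun y => inner ℝ y m) (h.vel_succ hj)
  simp only [inner_add_left, inner_smul_left, inner_sub_left, conj_trivial] at h1
  rw [h1]
  have := mul_nonneg (norm_nonneg (w (j + 1) - w j))
    (neg_nonneg.2 (inner_ctr_nonpos (ξ := ξ) hum hem hvm (j + 1)))
  linarith

theorem transverse_nonneg (h : IsOrbit u ξ v n τ x w) {m : E3} (hum : inner ℝ u m = 0)
    (hem : inner ℝ e m = 0) (hvm : 0 ≤ inner ℝ v m) {j : ℕ} (hj : j ≤ n) :
    0 ≤ inner ℝ (x j) m ∧ 0 ≤ inner ℝ (w j) m := by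
  induction j with
  | zero => rw [h.pos_zero, h.vel_zero, inner_smul_left, hum]; simpa using hvm
  | succ j ih =>
    obtain ⟨h1, h2⟩ := ih (by omega)
    have h3 := h.inner_pos_succ m hj
    have h4 := h.inner_vel_succ hum hem hvm hj
    have h5 := mul_nonneg (h.time_nonneg j hj) h2
    have h6 : 0 ≤ inner ℝ (x (j + 1)) m := by linarith
    exact ⟨h6, by linarith [mul_nonneg (norm_nonneg (w (j + 1) - w j)) h6]⟩

/-- Each kick between i and j adds at least its length times x_i·m to the transverse velocity, and
by the triangle inequality these lengths sum to at least the total turn |w_j - w_i|. -/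
theorem transverse_mono (h : IsOrbit u ξ v n τ x w) {m : E3} (hum : inner ℝ u m = 0)
    (hem : inner ℝ e m = 0) (hvm : 0 ≤ inner ℝ v m) {i j : ℕ} (hij : i ≤ j) (hj : j ≤ n) :
    inner ℝ (x i) m ≤ inner ℝ (x j) m ∧ inner ℝ (w i) m ≤ inner ℝ (w j) m ∧
      inner ℝ (x i) m * ‖w j - w i‖ ≤ inner ℝ (w j) m - inner ℝ (w i) m := by
  induction j, hij using Nat.le_induction with
  | base => simp
  | succ j hij ih =>
    obtain ⟨h1, h2, h3⟩ := ih (by omega)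
    obtain ⟨p1, p2⟩ := h.transverse_nonneg hum hem hvm (j := j) (by omega)
    have p3 := (h.transverse_nonneg hum hem hvm (j := i) (by omega)).1
    have p4 := (h.transverse_nonneg hum hem hvm hj).1
    have h4 := h.inner_pos_succ m hj
    have h5 := h.inner_vel_succ hum hem hvm hj
    have h6 := mul_nonneg (h.time_nonneg j hj) p2
    have h7 : inner ℝ (x i) m ≤ inner ℝ (x (j + 1)) m := by linarith
    have h8 := mul_le_mul_of_nonneg_left h7 (norm_nonneg (w (j + 1) - w j))
    have h9 : ‖w (j + 1) - w i‖ ≤ ‖w (j + 1) - w j‖ + ‖w j - w i‖ := norm_sub_le_norm_sub_add_norm_sub ..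
    have h10 := mul_le_mul_of_nonneg_left h9 p3
    refine ⟨h7, ?_, by linarith⟩
    linarith [mul_nonneg (norm_nonneg (w (j + 1) - w j)) p4]

theorem transverse_pos_le_one (h : IsOrbit u ξ v n τ x w) {m : E3} (hm : ‖m‖ = 1)
    (hum : inner ℝ u m = 0) (hem : inner ℝ e m = 0) (hvm : 0 ≤ inner ℝ v m) {j : ℕ} (hj : j ≤ n) :
    inner ℝ (x j) m ≤ 1 := by
  rcases Nat.eq_zero_or_pos j with rfl | hp
  · rw [h.pos_zero, inner_smul_left, hum]; simp
  obtain ⟨i, rfl⟩ : ∃ i, j = i + 1 := ⟨j - 1, by omega⟩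
  have h1 := abs_inner_le_of_norm_eq_one (x := x (i + 1) - ctr u ξ v (i + 1)) hm
  rw [h.sphere i hj, inner_sub_left] at h1
  linarith [le_abs_self (inner ℝ (x (i + 1)) m - inner ℝ (ctr u ξ v (i + 1)) m),
    inner_ctr_nonpos (ξ := ξ) hum hem hvm (i + 1)]

end IsOrbit

/-- The time of the `j`-th of the further collisions. -/
noncomputable def clock (ξ : ℝ) (τ : ℕ → ℝ) (j : ℕ) : ℝ := ξ + ∑ i ∈ Finset.range j, τ i

theorem clock_zero (ξ : ℝ) (τ : ℕ → ℝ) : clock ξ τ 0 = ξ := by simp [clock]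

theorem clock_succ (ξ : ℝ) (τ : ℕ → ℝ) (j : ℕ) : clock ξ τ (j + 1) = clock ξ τ j + τ j := by
  rw [clock, clock, Finset.sum_range_succ, add_assoc]

/-- The inner product is at least ξ² - 8ξ - 16, which is positive at ξ = 10; hence the threshold 10
between near and distant scatterers. -/
theorem inner_nonneg_of_near {u y y' : E3} {ξ : ℝ} (hu : ‖u‖ = 1) (hξ : 10 ≤ ξ) (hy : ‖y‖ ≤ 4)
    (hy' : ‖y'‖ ≤ 4) : 0 ≤ inner ℝ (ξ • u + y) (ξ • u + y') := by
  simp only [inner_add_left, inner_add_right, inner_smul_left, inner_smul_right, conj_trivial,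
    real_inner_self_eq_norm_sq, hu]
  have h1 := abs_le.1 (abs_inner_le_of_norm_eq_one (x := y) hu)
  have h2 := abs_le.1 (abs_inner_le_of_norm_eq_one (x := y') hu)
  have h3 := abs_le.1 (abs_real_inner_le_norm y y')
  have h4 : ‖y‖ * ‖y'‖ ≤ 4 * 4 := mul_le_mul hy hy' (norm_nonneg _) (by norm_num)
  rw [real_inner_comm] at h2
  nlinarith

/-! ### Long trapping forces transverse growth -/

namespace IsOrbit

variable {u v : E3} {ξ : ℝ} {n : ℕ} {τ : ℕ → ℝ} {x w : ℕ → E3}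

theorem time_le (h : IsOrbit u ξ v n τ x w) (hu1 : ‖u‖ = 1) (hv1 : ‖v‖ = 1) (hu : u ≠ e)
    (huv : u ≠ v) (hξ : 0 < ξ) {j : ℕ} (hj : j < n) : τ j ≤ ξ + 4 := by
  rw [← h.norm_pos_sub hv1 hj]
  exact h.norm_pos_sub_le hu1 hu huv hξ hj hj.le

theorem clock_mono (h : IsOrbit u ξ v n τ x w) {i j : ℕ} (hij : i ≤ j) (hj : j ≤ n) :
    clock ξ τ i ≤ clock ξ τ j := by
  induction j, hij using Nat.le_induction with
  | base => rfl
  | succ j hij ih => rw [clock_succ]; linarith [ih (by omega), h.time_nonneg j hj]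

theorem inner_pos_ge (h : IsOrbit u ξ v n τ x w) {m : E3} (hum : inner ℝ u m = 0)
    (hem : inner ℝ e m = 0) (hvm : 0 ≤ inner ℝ v m) {i j : ℕ} (hij : i ≤ j) (hj : j ≤ n) :
    inner ℝ (x i) m + (clock ξ τ j - clock ξ τ i) * inner ℝ (w i) m ≤ inner ℝ (x j) m := by
  induction j, hij using Nat.le_induction with
  | base => simp
  | succ j hij ih =>
    have h1 := ih (by omega)
    have h2 := h.inner_pos_succ m hj
    have h3 := (h.transverse_mono hum hem hvm hij (by omega)).2.1
    have h4 := mul_le_mul_of_nonneg_left h3 (h.time_nonneg j hj)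
    rw [clock_succ]; linarith

/-- A particle that stays in a bounded region for a long time turns considerably. -/
theorem exists_turn (h : IsOrbit u ξ v n τ x w) (hu1 : ‖u‖ = 1) (hv1 : ‖v‖ = 1) (hu : u ≠ e)
    (huv : u ≠ v) (hξ : 0 < ξ) {i j : ℕ} (hij : i ≤ j) (hj : j ≤ n)
    (ht : clock ξ τ i + 2 * (ξ + 4) ≤ clock ξ τ j) : ∃ l, i ≤ l ∧ l < j ∧ 1 / 2 ≤ ‖w l - w i‖ := by
  by_contra! hcon
  -- While the turn stays below 1/2, w_k·w_i ≥ 1 - (1/2)²/2 = 7/8, so the particle drifts along w_i;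
  -- after time 2(ξ + 4) it has left every region of diameter ξ + 4.
  have key : ∀ k, i ≤ k → k ≤ j →
      7 / 8 * (clock ξ τ k - clock ξ τ i) ≤ inner ℝ (x k - x i) (w i) := by
    intro k hik
    induction k, hik using Nat.le_induction with
    | base => simp
    | succ k hik ih =>
      intro hk
      have h1 := ih (by omega)
      have h2 := hcon k hik hk
      have h3 := norm_sub_sq_real (w k) (w i)
      rw [h.norm_vel hv1 (by omega), h.norm_vel hv1 (by omega)] at h3
      have h4 : 7 / 8 ≤ inner ℝ (w k) (w i) := by nlinarith [norm_nonneg (w k - w i)]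
      have h5 := mul_le_mul_of_nonneg_left h4 (h.time_nonneg k (by omega))
      rw [clock_succ, h.flight k (by omega), add_sub_right_comm (x k), inner_add_left,
        inner_smul_left]
      simp only [conj_trivial]
      linarith
  have h1 := key j hij le_rfl
  have h2 := real_inner_le_norm (x j - x i) (w i)
  rw [h.norm_vel hv1 (by omega), mul_one] at h2
  have h3 := h.norm_pos_sub_le hu1 hu huv hξ hj (hij.trans hj)
  linarith

/-- During the window the turn raises w·m by at least half of x·m, and the flights raise x·m by at
least half of w·m; so the sum gains a factor 3/2. -/
theorem exists_growth (h : IsOrbit u ξ v n τ x w) (hu1 : ‖u‖ = 1) (hv1 : ‖v‖ = 1) (hu : u ≠ e)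
    (huv : u ≠ v) (hξ : 0 < ξ) {m : E3} (hum : inner ℝ u m = 0)
    (hem : inner ℝ e m = 0) (hvm : 0 ≤ inner ℝ v m) {i k : ℕ} (hik : i ≤ k) (hk : k ≤ n)
    (ht : clock ξ τ i + 3 * (ξ + 4) ≤ clock ξ τ k) :
    ∃ j, i ≤ j ∧ j ≤ k ∧ clock ξ τ j ≤ clock ξ τ i + 3 * (ξ + 4) ∧
      3 / 2 * (inner ℝ (x i) m + inner ℝ (w i) m) ≤ inner ℝ (x j) m + inner ℝ (w j) m := by
  -- The first index past time 2(ξ + 4) overshoots by at most one flight, of length at most ξ + 4;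
  -- hence the window 3(ξ + 4).
  have hex : ∃ j, i ≤ j ∧ clock ξ τ i + 2 * (ξ + 4) ≤ clock ξ τ j := ⟨k, hik, by linarith⟩
  classical
  obtain ⟨hij, hj⟩ := Nat.find_spec hex
  have hjk : Nat.find hex ≤ k := Nat.find_min' hex ⟨hik, by linarith⟩
  have hmin := fun {l} => Nat.find_min hex (m := l)
  generalize Nat.find hex = j at *
  obtain ⟨l, hil, hlj, hl⟩ := h.exists_turn hu1 hv1 hu huv hξ hij (by omega) hj
  refine ⟨j, hij, hjk, ?_, ?_⟩
  · obtain ⟨j, rfl⟩ : ∃ j', j = j' + 1 := ⟨j - 1, by omega⟩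
    have h1 := hmin (Nat.lt_succ_self j)
    simp only [not_and, not_le] at h1
    rw [clock_succ]
    linarith [h1 (by omega), h.time_le hu1 hv1 hu huv hξ (j := j) (by omega)]
  · have h1 := (h.transverse_mono hum hem hvm hil (by omega)).2.2
    have h2 := (h.transverse_mono hum hem hvm hlj.le (by omega)).2.1
    have h3 := h.inner_pos_ge hum hem hvm hij (by omega)
    obtain ⟨p1, p2⟩ := h.transverse_nonneg hum hem hvm (j := i) (by omega)
    have h4 := mul_le_mul_of_nonneg_left hl p1
    have h5 : 1 / 2 * inner ℝ (w i) m ≤ (clock ξ τ j - clock ξ τ i) * inner ℝ (w i) m :=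
      mul_le_mul_of_nonneg_right (by linarith) p2
    linarith

theorem growth_pow (h : IsOrbit u ξ v n τ x w) (hu1 : ‖u‖ = 1) (hv1 : ‖v‖ = 1) (hu : u ≠ e)
    (huv : u ≠ v) (hξ : 0 < ξ) {m : E3} (hm : ‖m‖ = 1) (hum : inner ℝ u m = 0)
    (hem : inner ℝ e m = 0) (hvm : 0 ≤ inner ℝ v m) (N : ℕ) {i : ℕ} (hi : i ≤ n)
    (ht : clock ξ τ i + 3 * (ξ + 4) * N ≤ clock ξ τ n) :
    (3 / 2) ^ N * (inner ℝ (x i) m + inner ℝ (w i) m) ≤ 2 := by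
  induction N generalizing i with
  | zero =>
    have h1 := h.transverse_pos_le_one hm hum hem hvm hi
    have h2 := (le_abs_self _).trans (abs_inner_le_of_norm_eq_one (x := w i) hm)
    rw [h.norm_vel hv1 hi] at h2
    linarith
  | succ N ih =>
    push_cast at ht
    have h0 : 0 ≤ 3 * (ξ + 4) * (N : ℝ) := by positivity
    obtain ⟨j, hij, hjn, hj1, hj2⟩ :=
      h.exists_growth hu1 hv1 hu huv hξ hum hem hvm hi le_rfl (by linarith)
    have h1 := ih hjn (by linarith)
    have h2 : (0 : ℝ) ≤ (3 / 2) ^ N := by positivity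
    rw [pow_succ]
    nlinarith [mul_le_mul_of_nonneg_left hj2 h2]

/-! ### Distant scatterers -/

/-- Flights alternate between neighbourhoods of ξ u and of the origin, so they are ±ξ u up to an
error of two diameters. -/
theorem exists_flight_eq (h : IsOrbit u ξ v n τ x w) (hu : u ≠ e) (huv : u ≠ v) {j : ℕ}
    (hj : j < n) : ∃ y, ‖y‖ ≤ 4 ∧ τ j • w j = (-1 : ℝ) ^ (j + 1) • (ξ • u + y) := by
  have h1 : τ j • w j = x (j + 1) - x j := by rw [h.flight j hj, add_sub_cancel_left]
  rcases Nat.even_or_odd j with ej | oj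
  · have a := h.norm_pos_of_even huv hj.le ej
    have b := h.norm_pos_of_odd hu hj ej.add_one
    refine ⟨(x j - ξ • u) - x (j + 1), (norm_sub_le _ _).trans (by linarith), ?_⟩
    rw [h1, ej.add_one.neg_one_pow, neg_one_smul]; abel
  · have a := h.norm_pos_of_even huv hj oj.add_one
    have b := h.norm_pos_of_odd hu hj.le oj
    refine ⟨(x (j + 1) - ξ • u) - x j, (norm_sub_le _ _).trans (by linarith), ?_⟩
    rw [h1, oj.add_one.neg_one_pow, one_smul]; abel

theorem le_time (h : IsOrbit u ξ v n τ x w) (hu1 : ‖u‖ = 1) (hv1 : ‖v‖ = 1) (hu : u ≠ e)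
    (huv : u ≠ v) {j : ℕ} (hj : j < n) : ξ - 4 ≤ τ j := by
  obtain ⟨y, hy, hy'⟩ := h.exists_flight_eq hu huv hj
  have h1 := congrArg norm hy'
  rw [norm_smul, norm_smul, h.norm_vel hv1 hj.le, norm_pow, norm_neg, norm_one, one_pow, one_mul,
    mul_one, Real.norm_of_nonneg (h.time_nonneg j hj)] at h1
  have h2 := norm_sub_le (ξ • u + y) y
  rw [add_sub_cancel_right, norm_smul, hu1, Real.norm_eq_abs] at h2
  linarith [le_abs_self ξ]

theorem le_time_zero (h : IsOrbit u ξ v n τ x w) (hu1 : ‖u‖ = 1) (hv1 : ‖v‖ = 1) (hu : u ≠ e)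
    (hn : 0 < n) : ξ - 2 ≤ τ 0 := by
  have h1 := h.norm_pos_sub hv1 hn
  have h2 := norm_sub_le (x (0 + 1)) (x (0 + 1) - x 0)
  have h3 := h.norm_pos_of_odd hu (j := 0 + 1) hn (by simp)
  rw [sub_sub_cancel, h.pos_zero, norm_smul, hu1, Real.norm_eq_abs, ← h.pos_zero] at h2
  linarith [le_abs_self ξ]

theorem inner_vel_nonneg {v' : E3} {τ' : ℕ → ℝ} {x' w' : ℕ → E3} (h : IsOrbit u ξ v n τ x w)
    (h' : IsOrbit u ξ v' n τ' x' w') (hu1 : ‖u‖ = 1) (hv1 : ‖v‖ = 1) (hv1' : ‖v'‖ = 1) (hu : u ≠ e)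
    (huv : u ≠ v) (huv' : u ≠ v') (hξ : 10 ≤ ξ) {j : ℕ} (hj : j < n) :
    0 ≤ inner ℝ (w j) (w' j) := by
  obtain ⟨y, hy, e1⟩ := h.exists_flight_eq hu huv hj
  obtain ⟨y', hy', e2⟩ := h'.exists_flight_eq hu huv' hj
  have h1 := inner_nonneg_of_near hu1 hξ hy hy'
  have h2 : τ j * (τ' j * inner ℝ (w j) (w' j)) = inner ℝ (ξ • u + y) (ξ • u + y') := by
    rw [← real_inner_smul_right, ← real_inner_smul_left, e1, e2, real_inner_smul_left,
      real_inner_smul_right, ← mul_assoc, ← mul_pow]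
    norm_num
  have t1 := h.le_time hu1 hv1 hu huv hj
  have t2 := h'.le_time hu1 hv1' hu huv' hj
  rw [← h2, ← mul_assoc] at h1
  exact nonneg_of_mul_nonneg_right h1 (mul_pos (by linarith) (by linarith))

/-- Successive flights are nearly opposite, so w_j·w_{j+1} ≤ 0 and the kick is at least √2 > 7/5.
The last collision is excluded, as no flight between the balls follows it. -/
theorem le_norm_vel_sub (h : IsOrbit u ξ v n τ x w) (hu1 : ‖u‖ = 1) (hv1 : ‖v‖ = 1) (hu : u ≠ e)
    (huv : u ≠ v) (hξ : 10 ≤ ξ) {j : ℕ} (hj : j + 1 < n) : 7 / 5 ≤ ‖w (j + 1) - w j‖ := by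
  obtain ⟨y, hy, e1⟩ := h.exists_flight_eq hu huv (j := j) (by omega)
  obtain ⟨y', hy', e2⟩ := h.exists_flight_eq hu huv hj
  have h1 := inner_nonneg_of_near hu1 hξ hy hy'
  have h2 : τ j * (τ (j + 1) * -inner ℝ (w j) (w (j + 1))) =
      inner ℝ (ξ • u + y) (ξ • u + y') := by
    rw [mul_neg, ← real_inner_smul_right, mul_neg, ← real_inner_smul_left, e1, e2,
      real_inner_smul_left, real_inner_smul_right, pow_succ _ (j + 1), ← mul_assoc, ← mul_assoc,
      ← mul_pow]
    norm_num
  have t1 := h.le_time hu1 hv1 hu huv (j := j) (by omega)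
  have t2 := h.le_time hu1 hv1 hu huv hj
  rw [← h2, ← mul_assoc] at h1
  have h3 := nonneg_of_mul_nonneg_right h1 (mul_pos (by linarith) (by linarith))
  have h4 := norm_sub_sq_real (w (j + 1)) (w j)
  rw [h.norm_vel hv1 (by omega), h.norm_vel hv1 (by omega), real_inner_comm] at h4
  nlinarith [norm_nonneg (w (j + 1) - w j)]

/-- With u·v > 0 the first flight would increase the u-component beyond ξ, away from the first ball.
The consequence |u - v| ≥ 1 makes the second centre depend on v in a Lipschitz way. -/
theorem inner_vel_zero_nonpos (h : IsOrbit u ξ v n τ x w) (hu1 : ‖u‖ = 1) (hv1 : ‖v‖ = 1)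
    (hu : u ≠ e) (hξ : 10 ≤ ξ) (hn : 0 < n) : inner ℝ u v ≤ 0 := by
  have h1 := h.flight 0 hn
  have h2 := h.norm_pos_of_odd hu (j := 0 + 1) hn (by simp)
  have h3 := (le_abs_self _).trans (abs_inner_le_of_norm_eq_one (x := x (0 + 1)) hu1)
  rw [h1, h.pos_zero, h.vel_zero, inner_add_left, inner_smul_left, inner_smul_left,
    real_inner_self_eq_norm_sq, hu1, ← h.vel_zero, ← h.pos_zero, ← h1] at h3
  simp only [conj_trivial] at h3
  have h4 := h.le_time_zero hu1 hv1 hu hn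
  rw [real_inner_comm, ← h.vel_zero]
  by_contra! hc
  nlinarith [mul_pos (show 0 < τ 0 by linarith) hc]

theorem one_le_norm_sub {u v : E3} (hu1 : ‖u‖ = 1) (hv1 : ‖v‖ = 1) (h : inner ℝ u v ≤ 0) :
    1 ≤ ‖u - v‖ := by
  have := norm_sub_sq_real u v
  rw [hu1, hv1] at this
  nlinarith [norm_nonneg (u - v)]

end IsOrbit

theorem norm_ctr_sub_le {u v v' : E3} {ξ : ℝ} (hv : 1 ≤ ‖u - v‖) (hv' : 1 ≤ ‖u - v'‖) (j : ℕ) :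
    ‖ctr u ξ v j - ctr u ξ v' j‖ ≤ ‖v - v'‖ := by
  unfold ctr
  split_ifs
  · simp
  have h1 : u - v ≠ 0 := norm_pos_iff.1 (by linarith)
  have h2 : u - v' ≠ 0 := norm_pos_iff.1 (by linarith)
  have h := norm_smul_sub_smul_ge (norm_inv_norm_smul h1) (norm_inv_norm_smul h2) zero_le_one hv hv'
  rw [smul_inv_smul₀ (norm_ne_zero_iff.2 h1), smul_inv_smul₀ (norm_ne_zero_iff.2 h2),
    sub_sub_sub_cancel_left, one_mul, norm_sub_rev v'] at h
  rwa [centerB, centerB, one_smul, one_smul, add_sub_add_left_eq_sub]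

/-! ### Expansion of the difference of two orbits -/

namespace IsOrbit

variable {u v v' : E3} {ξ : ℝ} {n : ℕ} {τ τ' : ℕ → ℝ} {x w x' w' : ℕ → E3}

theorem norm_pos_sub_succ_ge (h : IsOrbit u ξ v n τ x w) (h' : IsOrbit u ξ v' n τ' x' w')
    (hv1 : ‖v‖ = 1) (hv1' : ‖v'‖ = 1) {j : ℕ} (hj : j < n) {t : ℝ} (ht0 : 0 ≤ t) (ht : t ≤ τ j)
    (ht' : t ≤ τ' j) : t * ‖w j - w' j‖ - ‖x j - x' j‖ ≤ ‖x (j + 1) - x' (j + 1)‖ := by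
  have h1 := norm_smul_sub_smul_ge (h.norm_vel hv1 hj.le) (h'.norm_vel hv1' hj.le) ht0 ht ht'
  rw [h.flight j hj, h'.flight j hj, add_sub_add_comm]
  have h2 := norm_sub_le ((x j - x' j) + (τ j • w j - τ' j • w' j)) (x j - x' j)
  rw [add_sub_cancel_left] at h2
  linarith

/-- Two orbits with the same first scatterer and the same first free flight separate
exponentially fast. -/
theorem separation (h : IsOrbit u ξ v n τ x w) (h' : IsOrbit u ξ v' n τ' x' w')
    (hu1 : ‖u‖ = 1) (hv1 : ‖v‖ = 1) (hv1' : ‖v'‖ = 1) (hu : u ≠ e) (huv : u ≠ v) (huv' : u ≠ v')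
    (hξ : 10 ≤ ξ) {j : ℕ} (hj : j + 1 < n) :
    10 * ‖v - v'‖ ≤ ‖w (j + 1) - w' (j + 1)‖ ∧
      ‖x (j + 1) - x' (j + 1)‖ ≤ 6 / 5 * ‖w (j + 1) - w' (j + 1)‖ ∧
      3 ^ j * ((ξ - 3) * ‖v - v'‖) ≤ ‖w (j + 1) - w' (j + 1)‖ := by
  have d1 := one_le_norm_sub hu1 hv1 (h.inner_vel_zero_nonpos hu1 hv1 hu hξ (by omega))
  have d1' := one_le_norm_sub hu1 hv1' (h'.inner_vel_zero_nonpos hu1 hv1' hu hξ (by omega))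
  have step : ∀ i, i + 1 < n → 7 / 5 * ‖(x (i + 1) - ctr u ξ v (i + 1)) -
      (x' (i + 1) - ctr u ξ v' (i + 1))‖ ≤ ‖w (i + 1) - w' (i + 1)‖ + ‖w i - w' i‖ := by
    intro i hi
    have f1 := h.le_norm_vel_sub hu1 hv1 hu huv hξ hi
    have f2 := h'.le_norm_vel_sub hu1 hv1' hu huv' hξ hi
    rw [h.norm_vel_sub (by omega)] at f1
    rw [h'.norm_vel_sub (by omega)] at f2
    have := norm_reflection_sub_reflection_ge (h.sphere i (by omega)) (h'.sphere i (by omega))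
      (by norm_num) f1 f2
    rwa [← h.reflection i (by omega), ← h'.reflection i (by omega)] at this
  induction j with
  | zero =>
    have h1 := step 0 hj
    -- The first scatterer does not depend on v, so a difference in v acts only through the flight
    -- of length at least ξ - 2.
    have hc : ctr u ξ v (0 + 1) = ctr u ξ v' (0 + 1) := by simp [ctr]
    have h2 := h.norm_pos_sub_succ_ge h' hv1 hv1' (j := 0) (by omega) (t := ξ - 2) (by linarith)
      (h.le_time_zero hu1 hv1 hu (by omega)) (h'.le_time_zero hu1 hv1' hu (by omega))
    rw [hc, sub_sub_sub_cancel_right] at h1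
    rw [h.pos_zero, h'.pos_zero, h.vel_zero, h'.vel_zero, sub_self, norm_zero, sub_zero] at h2
    rw [h.vel_zero, h'.vel_zero] at h1
    have h3 : 8 * ‖v - v'‖ ≤ (ξ - 2) * ‖v - v'‖ :=
      mul_le_mul_of_nonneg_right (by linarith) (norm_nonneg _)
    have h4 := norm_nonneg (v - v')
    refine ⟨by linarith, by linarith, by linarith⟩
  | succ j ih =>
    -- With W the velocity gap, the positions separate by at least 6W - 6W/5 and the centres by at
    -- most W/10; the kick bound then gives a new gap of at least (7/5)(47/10)W - W > 5W, more than
    -- the factor 3 claimed.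
    obtain ⟨a1, a2, a3⟩ := ih (by omega)
    have h1 := step (j + 1) hj
    have h2 := h.norm_pos_sub_succ_ge h' hv1 hv1' (j := j + 1) (by omega) (t := ξ - 4) (by linarith)
      (h.le_time hu1 hv1 hu huv (by omega)) (h'.le_time hu1 hv1' hu huv' (by omega))
    have h3 : 6 * ‖w (j + 1) - w' (j + 1)‖ ≤ (ξ - 4) * ‖w (j + 1) - w' (j + 1)‖ :=
      mul_le_mul_of_nonneg_right (by linarith) (norm_nonneg _)
    have h4 := norm_ctr_sub_le (ξ := ξ) d1 d1' (j + 1 + 1)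
    have h5 := norm_sub_norm_le (x (j + 1 + 1) - x' (j + 1 + 1))
      (ctr u ξ v (j + 1 + 1) - ctr u ξ v' (j + 1 + 1))
    rw [sub_sub_sub_comm] at h5
    have h6 := norm_nonneg (v - v')
    have h7 := norm_nonneg (w (j + 1) - w' (j + 1))
    have h8 : 3 ^ (j + 1) * ((ξ - 3) * ‖v - v'‖) = 3 * (3 ^ j * ((ξ - 3) * ‖v - v'‖)) := by ring
    refine ⟨by linarith, by linarith, by linarith⟩

end IsOrbit

/-! ### The last collision -/

/-- The component of the cross product of `x` and `y` orthogonal to the plane of `p` and `q`. -/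
noncomputable def cross2 (p q x y : E3) : ℝ :=
  inner ℝ x p * inner ℝ y q - inner ℝ x q * inner ℝ y p

theorem inner_eq_basis (b : OrthonormalBasis (Fin 3) ℝ E3) (x y : E3) :
    inner ℝ x y = inner ℝ x (b 0) * inner ℝ y (b 0) + inner ℝ x (b 1) * inner ℝ y (b 1) +
      inner ℝ x (b 2) * inner ℝ y (b 2) := by
  rw [← b.sum_inner_mul_inner x y, Fin.sum_univ_three]
  simp only [real_inner_comm y]

theorem abs_cross2_le (b : OrthonormalBasis (Fin 3) ℝ E3) (x y : E3) :
    |cross2 (b 0) (b 1) x y| ≤ ‖x‖ * ‖y‖ := by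
  refine abs_le_of_sq_le_sq ?_ (by positivity)
  rw [mul_pow, ← real_inner_self_eq_norm_sq, ← real_inner_self_eq_norm_sq, inner_eq_basis b x x,
    inner_eq_basis b y y, cross2]
  generalize inner ℝ x (b 0) = x0, inner ℝ x (b 1) = x1, inner ℝ x (b 2) = x2,
    inner ℝ y (b 0) = y0, inner ℝ y (b 1) = y1, inner ℝ y (b 2) = y2
  nlinarith [sq_nonneg (x0 * y0 + x1 * y1), sq_nonneg (x0 * y2), sq_nonneg (x1 * y2),
    sq_nonneg (x2 * y2), sq_nonneg (x2 * y0), sq_nonneg (x2 * y1)]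

/-- By Lagrange's identity the middle quantity is the squared length of the cross product; `cross2`
is one component, and the other two are controlled by the components of x and y along `b 2`. -/
theorem cross2_sq_le {b : OrthonormalBasis (Fin 3) ℝ E3} {x y : E3} (hx : ‖x‖ = 1) (hy : ‖y‖ = 1) :
    cross2 (b 0) (b 1) x y ^ 2 ≤ 1 - inner ℝ x y ^ 2 ∧
      1 - inner ℝ x y ^ 2 ≤
        cross2 (b 0) (b 1) x y ^ 2 + (|inner ℝ x (b 2)| + |inner ℝ y (b 2)|) ^ 2 := by
  have h1 := inner_eq_basis b x x
  have h2 := inner_eq_basis b y y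
  rw [real_inner_self_eq_norm_sq] at h1 h2
  rw [hx] at h1
  rw [hy] at h2
  rw [inner_eq_basis b x y, cross2]
  generalize inner ℝ x (b 0) = x0, inner ℝ x (b 1) = x1, inner ℝ x (b 2) = x2,
    inner ℝ y (b 0) = y0, inner ℝ y (b 1) = y1, inner ℝ y (b 2) = y2 at *
  have h3 : 1 - (x0 * y0 + x1 * y1 + x2 * y2) ^ 2 =
      (x0 * y1 - x1 * y0) ^ 2 + ((x0 * y2 - x2 * y0) ^ 2 + (x1 * y2 - x2 * y1) ^ 2) := by
    linear_combination (y0 * y0 + y1 * y1 + y2 * y2) * h1 + h2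
  rw [h3]
  refine ⟨by nlinarith [sq_nonneg (x0 * y2 - x2 * y0), sq_nonneg (x1 * y2 - x2 * y1)], ?_⟩
  have h4 : |x0 * y0 + x1 * y1| ≤ 1 := by
    rw [abs_le]
    constructor <;> nlinarith [sq_nonneg (x0 + y0), sq_nonneg (x1 + y1), sq_nonneg (x0 - y0),
      sq_nonneg (x1 - y1), sq_nonneg x2, sq_nonneg y2]
  have h5 : -(x2 * y2 * (x0 * y0 + x1 * y1)) ≤ |x2| * |y2| := by
    refine (neg_le_abs _).trans ?_
    rw [abs_mul, abs_mul]
    exact mul_le_of_le_one_right (by positivity) h4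
  have h6 : (|x2| + |y2|) ^ 2 = x2 ^ 2 + y2 ^ 2 + 2 * (|x2| * |y2|) := by
    rw [add_sq, sq_abs, sq_abs]; ring
  rw [h6]
  have h7 : (x0 * y2 - x2 * y0) ^ 2 + (x1 * y2 - x2 * y1) ^ 2 =
      y2 ^ 2 * (1 - x2 ^ 2) + x2 ^ 2 * (1 - y2 ^ 2) - 2 * (x2 * y2 * (x0 * y0 + x1 * y1)) := by
    linear_combination (-y2 ^ 2) * h1 - x2 ^ 2 * h2
  nlinarith [sq_nonneg (x2 * y2)]

theorem abs_le_of_sq_le_sq_add_sq {a c d : ℝ} (hc : 0 ≤ c) (hd : 0 ≤ d)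
    (h : a ^ 2 ≤ c ^ 2 + d ^ 2) : a ≤ c + d := by
  by_contra! hcon
  nlinarith [mul_nonneg hc hd]

/-- The impact parameter is half the length of the sum of incoming and outgoing velocities. -/
theorem abs_cross2_normal {b : OrthonormalBasis (Fin 3) ℝ E3} {N w : E3} {κ δ : ℝ} (hN : ‖N‖ = 1)
    (hw : ‖w‖ = 1) (hNm : |inner ℝ N (b 2)| ≤ κ) (hwm : |inner ℝ w (b 2)| ≤ δ) :
    |cross2 (b 0) (b 1) N w| ≤ ‖w + (w - (2 * inner ℝ w N) • N)‖ / 2 ∧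
      ‖w + (w - (2 * inner ℝ w N) • N)‖ / 2 ≤ |cross2 (b 0) (b 1) N w| + (κ + δ) := by
  have h0 : (‖w + (w - (2 * inner ℝ w N) • N)‖ / 2) ^ 2 = 1 - inner ℝ N w ^ 2 := by
    have : w + (w - (2 * inner ℝ w N) • N) = (2 : ℝ) • (w - inner ℝ w N • N) := by
      rw [smul_sub, smul_smul, two_smul]; abel
    rw [this, norm_smul, Real.norm_ofNat, mul_div_cancel_left₀ _ two_ne_zero, norm_sub_sq_real,
      norm_smul, inner_smul_right, hN, hw, Real.norm_eq_abs, mul_one, sq_abs, real_inner_comm N w]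
    ring
  obtain ⟨h1, h2⟩ := cross2_sq_le (b := b) hN hw
  constructor
  · exact abs_le_of_sq_le_sq (by rw [h0]; exact h1) (by positivity)
  · have hκ := (abs_nonneg _).trans hNm
    have hδ := (abs_nonneg _).trans hwm
    refine abs_le_of_sq_le_sq_add_sq (abs_nonneg _) (by positivity) ?_
    rw [h0, sq_abs]
    refine h2.trans ?_
    gcongr

/-- For an angle of at most π/2 the sine is at least |w - w'|/√2, and 7/10 < 1/√2. -/
theorem le_abs_cross2 {b : OrthonormalBasis (Fin 3) ℝ E3} {w w' : E3} {δ : ℝ}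
    (hw : ‖w‖ = 1) (hw' : ‖w'‖ = 1) (hwm : |inner ℝ w (b 2)| ≤ δ) (hwm' : |inner ℝ w' (b 2)| ≤ δ)
    (hww : 0 ≤ inner ℝ w w') : 7 / 10 * ‖w - w'‖ - 2 * δ ≤ |cross2 (b 0) (b 1) w w'| := by
  have h1 := (cross2_sq_le (b := b) hw hw').2
  have hδ := (abs_nonneg _).trans hwm
  have h2 := norm_sub_sq_real w w'
  rw [hw, hw'] at h2
  have h3 : (7 / 10 * ‖w - w'‖) ^ 2 ≤ |cross2 (b 0) (b 1) w w'| ^ 2 + (2 * δ) ^ 2 := by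
    have : (|inner ℝ w (b 2)| + |inner ℝ w' (b 2)|) ^ 2 ≤ (2 * δ) ^ 2 := by
      gcongr; linarith
    rw [sq_abs]
    have h4 : inner ℝ w w' ≤ 1 := by simpa [hw, hw'] using real_inner_le_norm w w'
    nlinarith [mul_nonneg hww (sub_nonneg.2 h4)]
  linarith [abs_le_of_sq_le_sq_add_sq (abs_nonneg _) (by positivity) h3]

/-- Two trajectories which leave the unit spheres in nearly the same direction after a long flight
have nearly the same incoming velocity. -/
theorem last_collision {b : OrthonormalBasis (Fin 3) ℝ E3} {X X' N N' w w' f : E3}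
    {t t' κ δ : ℝ} (hN : ‖N‖ = 1) (hN' : ‖N'‖ = 1) (hw : ‖w‖ = 1) (hw' : ‖w'‖ = 1)
    (hNX : N = X + t • w) (hNX' : N' = X' + t' • w') (ht : 0 ≤ t)
    (hNm : |inner ℝ N (b 2)| ≤ κ) (hNm' : |inner ℝ N' (b 2)| ≤ κ)
    (hwm : |inner ℝ w (b 2)| ≤ δ) (hwm' : |inner ℝ w' (b 2)| ≤ δ) (hww : 0 ≤ inner ℝ w w')
    (hf : ‖w - (2 * inner ℝ w N) • N - f‖ ≤ δ) (hf' : ‖w' - (2 * inner ℝ w' N') • N' - f‖ ≤ δ)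
    (hJ : 0 ≤ cross2 (b 0) (b 1) N w ↔ 0 ≤ cross2 (b 0) (b 1) N' w') :
    t * (7 / 10 * ‖w - w'‖ - 2 * δ) ≤
      3 / 2 * ‖w - w'‖ + ‖X - X'‖ + 2 * κ + 3 * δ := by
  obtain ⟨a1, a2⟩ := abs_cross2_normal hN hw hNm hwm
  obtain ⟨a1', a2'⟩ := abs_cross2_normal hN' hw' hNm' hwm'
  set w1 := w - (2 * inner ℝ w N) • N
  set w1' := w' - (2 * inner ℝ w' N') • N'
  have h1 : |‖w + w1‖ - ‖w' + w1'‖| ≤ ‖w - w'‖ + 2 * δ := by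
    refine (abs_norm_sub_norm_le _ _).trans ?_
    have e1 : w + w1 - (w' + w1') = (w - w') + ((w1 - f) - (w1' - f)) := by abel
    rw [e1]
    refine (norm_add_le _ _).trans ?_
    linarith [norm_sub_le (w1 - f) (w1' - f)]
  -- The outgoing velocity determines the impact parameter only up to sign; `hJ` supplies the common
  -- sign.
  have h2 : |cross2 (b 0) (b 1) N w - cross2 (b 0) (b 1) N' w'| =
      |(|cross2 (b 0) (b 1) N w| - |cross2 (b 0) (b 1) N' w'|)| := by
    by_cases h0 : 0 ≤ cross2 (b 0) (b 1) N w
    · rw [abs_of_nonneg h0, abs_of_nonneg (hJ.1 h0)]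
    · have h0' := fun h => h0 (hJ.2 h)
      rw [not_le] at h0
      replace h0' := not_le.1 h0'
      rw [abs_of_neg h0, abs_of_neg h0', neg_sub_neg, abs_sub_comm]
  have h3 : |cross2 (b 0) (b 1) N w - cross2 (b 0) (b 1) N' w'| ≤
      ‖w - w'‖ / 2 + δ + (κ + δ) := by
    rw [h2]
    rw [abs_le] at h1 ⊢
    constructor <;> linarith
  -- Angular momentum is constant along a flight, N × w = X × w, so comparing the two flights
  -- isolates t times w × w'.
  have h4 : -(t * cross2 (b 0) (b 1) w w') =
      (cross2 (b 0) (b 1) N' w' - cross2 (b 0) (b 1) N w) + cross2 (b 0) (b 1) N (w - w') +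
        cross2 (b 0) (b 1) (X - X') w' := by
    rw [hNX', hNX]
    simp only [cross2, inner_add_left, inner_sub_left, inner_smul_left, conj_trivial]
    ring
  have h5 := abs_cross2_le b N (w - w')
  have h6 := abs_cross2_le b (X - X') w'
  rw [hN, one_mul] at h5
  rw [hw', mul_one] at h6
  have h7 : t * |cross2 (b 0) (b 1) w w'| ≤ (‖w - w'‖ / 2 + δ + (κ + δ)) + ‖w - w'‖ + ‖X - X'‖ := by
    have h8 : t * |cross2 (b 0) (b 1) w w'| = |-(t * cross2 (b 0) (b 1) w w')| := by
      rw [abs_neg, abs_mul, abs_of_nonneg ht]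
    rw [h8, h4]
    refine (abs_add_three _ _ _).trans ?_
    rw [abs_sub_comm]
    linarith
  have h8 := mul_le_mul_of_nonneg_left (le_abs_cross2 hw hw' hwm hwm' hww) ht
  have hκ := (abs_nonneg _).trans hNm
  have hδ := (abs_nonneg _).trans hwm
  linarith

/-! ### Orbits that exit near -e, and bounds on v from return and trapping -/

namespace IsOrbit

variable {u v v' : E3} {ξ : ℝ} {n : ℕ} {τ τ' : ℕ → ℝ} {x w x' w' : ℕ → E3}

theorem abs_inner_ctr_le {m : E3} (hum : inner ℝ u m = 0) (hem : inner ℝ e m = 0)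
    (huv : 1 ≤ ‖u - v‖) (j : ℕ) : |inner ℝ (ctr u ξ v j) m| ≤ |inner ℝ v m| := by
  unfold ctr
  split_ifs
  · rw [inner_centerA_of_orthogonal hum hem, abs_zero]; positivity
  · rw [inner_centerB_of_orthogonal hum, abs_neg, abs_mul, abs_inv, abs_norm]
    exact mul_le_of_le_one_left (abs_nonneg _) (inv_le_one_of_one_le₀ huv)

/-- For an orbit which leaves in a direction close to `-e`, the velocities remain nearly parallel to
the plane of the first collision. -/
theorem abs_inner_vel_le (h : IsOrbit u ξ v n τ x w) {m : E3} {δ : ℝ} (hm : ‖m‖ = 1)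
    (hum : inner ℝ u m = 0) (hem : inner ℝ e m = 0) (hδ : ‖w n + e‖ ≤ δ) {j : ℕ} (hj : j ≤ n) :
    |inner ℝ (w j) m| ≤ δ := by
  have key : ∀ m : E3, ‖m‖ = 1 → inner ℝ u m = 0 → inner ℝ e m = 0 → 0 ≤ inner ℝ v m →
      |inner ℝ (w j) m| ≤ δ := by
    intro m hm hum hem hvm
    rw [abs_of_nonneg (h.transverse_nonneg hum hem hvm hj).2]
    have h1 := (h.transverse_mono hum hem hvm hj le_rfl).2.1
    have h2 := (le_abs_self _).trans (abs_inner_le_of_norm_eq_one (x := w n + e) hm)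
    rw [inner_add_left, hem] at h2
    linarith
  rcases le_total 0 (inner ℝ v m) with h0 | h0
  · exact key m hm hum hem h0
  · have := key (-m) (by rwa [norm_neg]) (by rw [inner_neg_right, hum, neg_zero])
      (by rw [inner_neg_right, hem, neg_zero]) (by rw [inner_neg_right]; linarith)
    rwa [inner_neg_right, abs_neg] at this

/-- Before the last collision each kick is at least 7/5 long and turns a transverse displacement
into at least as much transverse velocity, which is at most δ. -/
theorem abs_inner_pos_le (h : IsOrbit u ξ v n τ x w) (hu1 : ‖u‖ = 1) (hv1 : ‖v‖ = 1) (hu : u ≠ e)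
    (huv : u ≠ v) (hξ : 10 ≤ ξ) {m : E3} {δ : ℝ} (hm : ‖m‖ = 1)
    (hum : inner ℝ u m = 0) (hem : inner ℝ e m = 0) (hδ : ‖w n + e‖ ≤ δ) {j : ℕ} (hj : j < n) :
    |inner ℝ (x j) m| ≤ δ := by
  have key : ∀ m : E3, ‖m‖ = 1 → inner ℝ u m = 0 → inner ℝ e m = 0 → 0 ≤ inner ℝ v m →
      |inner ℝ (x j) m| ≤ δ := by
    intro m hm hum hem hvm
    have p := (h.transverse_nonneg hum hem hvm hj.le).1
    rw [abs_of_nonneg p]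
    rcases j with _ | j
    · rw [h.pos_zero, inner_smul_left, hum, mul_zero]
      exact (norm_nonneg _).trans hδ
    · have h1 := h.le_norm_vel_sub hu1 hv1 hu huv hξ hj
      have h2 := h.inner_vel_succ hum hem hvm (j := j) (by omega)
      have h3 := (h.transverse_nonneg hum hem hvm (j := j) (by omega)).2
      have h4 := (le_abs_self _).trans (h.abs_inner_vel_le hm hum hem hδ (j := j + 1) hj.le)
      nlinarith [mul_le_mul_of_nonneg_right h1 p]
  rcases le_total 0 (inner ℝ v m) with h0 | h0
  · exact key m hm hum hem h0
  · have := key (-m) (by rwa [norm_neg]) (by rw [inner_neg_right, hum, neg_zero])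
      (by rw [inner_neg_right, hem, neg_zero]) (by rw [inner_neg_right]; linarith)
    rwa [inner_neg_right, abs_neg] at this

theorem abs_inner_normal_le (h : IsOrbit u ξ v (n + 1) τ x w) (hu1 : ‖u‖ = 1) (hv1 : ‖v‖ = 1)
    (hu : u ≠ e) (huv : u ≠ v) (hξ : 10 ≤ ξ) {m : E3} {δ : ℝ} (hm : ‖m‖ = 1)
    (hum : inner ℝ u m = 0) (hem : inner ℝ e m = 0) (hδ : ‖w (n + 1) + e‖ ≤ δ) :
    |inner ℝ (x (n + 1) - ctr u ξ v (n + 1)) m| ≤ δ * (ξ + 6) := by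
  have d1 := one_le_norm_sub hu1 hv1 (h.inner_vel_zero_nonpos hu1 hv1 hu hξ n.succ_pos)
  have h1 := abs_inner_ctr_le (ξ := ξ) hum hem d1 (n + 1)
  have h2 := h.abs_inner_vel_le hm hum hem hδ (Nat.zero_le _)
  rw [h.vel_zero] at h2
  have h3 := h.abs_inner_vel_le hm hum hem hδ (n.le_succ)
  have h4 := h.abs_inner_pos_le hu1 hv1 hu huv hξ hm hum hem hδ n.lt_succ_self
  have h5 := h.time_le hu1 hv1 hu huv (by linarith) n.lt_succ_self
  have h6 := h.time_nonneg n n.lt_succ_self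
  have h7 : |τ n * inner ℝ (w n) m| ≤ (ξ + 4) * δ := by
    rw [abs_mul, abs_of_nonneg h6]
    exact mul_le_mul h5 h3 (abs_nonneg _) (by linarith)
  rw [inner_sub_left, h.inner_pos_succ m n.lt_succ_self]
  replace h1 := h1.trans h2
  rw [abs_le] at *
  constructor <;> linarith

/-- A flight of length about ξ multiplies an angular difference ε into a difference ξε of impact
parameters, whereas nearly equal exit directions only allow O(ε + ξδ). -/
theorem vel_close (h : IsOrbit u ξ v (n + 1) τ x w) (h' : IsOrbit u ξ v' (n + 1) τ' x' w')
    (hu1 : ‖u‖ = 1) (hv1 : ‖v‖ = 1) (hv1' : ‖v'‖ = 1) (hu : u ≠ e) (huv : u ≠ v) (huv' : u ≠ v')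
    (hξ : 10 ≤ ξ) {δ : ℝ} (hδ : ‖w (n + 1) + e‖ ≤ δ) (hδ' : ‖w' (n + 1) + e‖ ≤ δ)
    {b : OrthonormalBasis (Fin 3) ℝ E3} (hum : inner ℝ u (b 2) = 0) (hem : inner ℝ e (b 2) = 0)
    (hJ : 0 ≤ cross2 (b 0) (b 1) (x (n + 1) - ctr u ξ v (n + 1)) (w n) ↔
      0 ≤ cross2 (b 0) (b 1) (x' (n + 1) - ctr u ξ v' (n + 1)) (w' n)) :
    ‖w n - w' n‖ ≤ 45 * δ := by
  have hn := n.lt_succ_self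
  have hb := b.norm_eq_one 2
  have t1 := h.le_time hu1 hv1 hu huv hn
  have t2 := h.time_le hu1 hv1 hu huv (by linarith) hn
  have hδ0 := (norm_nonneg _).trans hδ
  have hε := norm_nonneg (w n - w' n)
  have hX : ‖(x n - ctr u ξ v (n + 1)) - (x' n - ctr u ξ v' (n + 1))‖ ≤
      13 / 10 * ‖w n - w' n‖ := by
    rw [sub_sub_sub_comm]
    rcases n with _ | n
    · rw [h.pos_zero, h'.pos_zero]
      simp only [ctr, zero_add, odd_one, if_true, sub_self, norm_zero]
      positivity
    · obtain ⟨s1, s2, -⟩ := h.separation h' hu1 hv1 hv1' hu huv huv' hξ hn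
      have d1 := one_le_norm_sub hu1 hv1 (h.inner_vel_zero_nonpos hu1 hv1 hu hξ (by omega))
      have d1' := one_le_norm_sub hu1 hv1' (h'.inner_vel_zero_nonpos hu1 hv1' hu hξ (by omega))
      have h4 := norm_ctr_sub_le (ξ := ξ) d1 d1' (n + 1 + 1)
      refine (norm_sub_le _ _).trans ?_
      linarith
  have key := last_collision (f := -e) (h.sphere n hn) (h'.sphere n hn) (h.norm_vel hv1 hn.le)
    (h'.norm_vel hv1' hn.le) (X := x n - ctr u ξ v (n + 1)) (X' := x' n - ctr u ξ v' (n + 1))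
    (by rw [h.flight n hn]; abel) (by rw [h'.flight n hn]; abel) (h.time_nonneg n hn)
    (h.abs_inner_normal_le hu1 hv1 hu huv hξ hb hum hem hδ)
    (h'.abs_inner_normal_le hu1 hv1' hu huv' hξ hb hum hem hδ')
    (h.abs_inner_vel_le hb hum hem hδ hn.le) (h'.abs_inner_vel_le hb hum hem hδ' hn.le)
    (h.inner_vel_nonneg h' hu1 hv1 hv1' hu huv huv' hξ hn)
    (by rwa [← h.reflection n hn, sub_neg_eq_add]) (by rwa [← h'.reflection n hn, sub_neg_eq_add])
    hJ
  -- Altogether (7ξ/10 - 28/5)ε ≤ (4ξ + 23)δ; at ξ = 10 this reads (7/5)ε ≤ 63δ, whence 45, and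
  -- larger ξ is better.
  have k1 : (ξ - 4) * ‖w n - w' n‖ ≤ τ n * ‖w n - w' n‖ := mul_le_mul_of_nonneg_right t1 hε
  have k2 : τ n * δ ≤ (ξ + 4) * δ := mul_le_mul_of_nonneg_right t2 hδ0
  by_contra! hcon
  have k3 : ξ * (45 * δ) ≤ ξ * ‖w n - w' n‖ := mul_le_mul_of_nonneg_left hcon.le (by linarith)
  have k4 : 10 * ‖w n - w' n‖ ≤ ξ * ‖w n - w' n‖ := mul_le_mul_of_nonneg_right hξ hε
  have k5 : 10 * δ ≤ ξ * δ := mul_le_mul_of_nonneg_right hξ hδ0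
  have k6 : ξ * (45 * δ) < ξ * ‖w n - w' n‖ := mul_lt_mul_of_pos_left hcon (by linarith)
  linarith

/-- The return flight lasts at least ξ - 2 ≥ 4ξ/5 and ends within 2 of the origin, so |v·g| is at
most 2/(4ξ/5). -/
theorem abs_inner_vel_zero_le (h : IsOrbit u ξ v n τ x w) (hu1 : ‖u‖ = 1) (hv1 : ‖v‖ = 1)
    (hu : u ≠ e) (hξ : 10 ≤ ξ) (hn : 0 < n) {g : E3} (hg : ‖g‖ = 1) (hug : inner ℝ u g = 0) :
    |inner ℝ v g| ≤ 5 / 2 * ξ⁻¹ := by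
  have h1 := h.inner_pos_succ g hn
  have h2 := abs_inner_le_of_norm_eq_one (x := x (0 + 1)) hg
  have h3 := h.norm_pos_of_odd hu (j := 0 + 1) hn (by simp)
  rw [h1, h.pos_zero, inner_smul_left, hug, mul_zero, zero_add, abs_mul,
    h.vel_zero, abs_of_nonneg (h.time_nonneg 0 hn)] at h2
  have h4 := h.le_time_zero hu1 hv1 hu hn
  rw [← div_eq_mul_inv, le_div_iff₀ (by linarith)]
  nlinarith [mul_le_mul_of_nonneg_right h4 (abs_nonneg (inner ℝ v g)),
    mul_le_mul_of_nonneg_right hξ (abs_nonneg (inner ℝ v g))]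

theorem clock_one_le (h : IsOrbit u ξ v n τ x w) (hu1 : ‖u‖ = 1) (hv1 : ‖v‖ = 1) (hu : u ≠ e)
    (huv : u ≠ v) (hξ : 0 < ξ) (hn : 0 < n) : clock ξ τ 1 ≤ 2 * ξ + 4 := by
  rw [clock_succ, clock_zero]
  linarith [h.time_le hu1 hv1 hu huv hξ hn]

theorem pow_mul_abs_inner_le (h : IsOrbit u ξ v n τ x w) (hu1 : ‖u‖ = 1) (hv1 : ‖v‖ = 1)
    (hu : u ≠ e) (huv : u ≠ v) (hξ : 0 < ξ) {m : E3} (hm : ‖m‖ = 1)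
    (hum : inner ℝ u m = 0) (hem : inner ℝ e m = 0) {N : ℕ}
    (hN : N = 0 ∨ 3 * (ξ + 4) * (N + 1) ≤ clock ξ τ n) :
    (3 / 2) ^ N * |inner ℝ v m| ≤ 2 := by
  have key : ∀ m : E3, ‖m‖ = 1 → inner ℝ u m = 0 → inner ℝ e m = 0 → 0 ≤ inner ℝ v m →
      (3 / 2) ^ N * inner ℝ v m ≤ 2 := by
    intro m hm hum hem hvm
    have := h.growth_pow hu1 hv1 hu huv hξ hm hum hem hvm N (Nat.zero_le _) (by
      rcases hN with rfl | hN
      · simpa using h.clock_mono (Nat.zero_le _) le_rfl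
      · rw [clock_zero]; linarith)
    rwa [h.pos_zero, h.vel_zero, inner_smul_left, hum, mul_zero, zero_add] at this
  rcases le_total 0 (inner ℝ v m) with h0 | h0
  · rw [abs_of_nonneg h0]
    exact key m hm hum hem h0
  · rw [abs_of_nonpos h0, ← inner_neg_right]
    exact key (-m) (by rwa [norm_neg]) (by rw [inner_neg_right, hum, neg_zero])
      (by rw [inner_neg_right, hem, neg_zero]) (by rw [inner_neg_right]; linarith)

/-- The growth starts at the second further collision. By then, the flights of length at least 4ξ/5
and 3ξ/5 and the kick of at least 7/5 between them have raised v·m to a displacement of at least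
ξ²(v·m)/2. The additional window in `hN` absorbs the elapsed time, at most 3(ξ + 4). -/
theorem pow_mul_sq_mul_abs_inner_le (h : IsOrbit u ξ v n τ x w) (hu1 : ‖u‖ = 1) (hv1 : ‖v‖ = 1)
    (hu : u ≠ e) (huv : u ≠ v) (hξ : 10 ≤ ξ) (hn : 2 ≤ n) {m : E3} (hm : ‖m‖ = 1)
    (hum : inner ℝ u m = 0) (hem : inner ℝ e m = 0) {N : ℕ}
    (hN : N = 0 ∨ 3 * (ξ + 4) * (N + 1) ≤ clock ξ τ n) :
    (3 / 2) ^ N * (ξ ^ 2 * |inner ℝ v m|) ≤ 4 := by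
  have key : ∀ m : E3, ‖m‖ = 1 → inner ℝ u m = 0 → inner ℝ e m = 0 → 0 ≤ inner ℝ v m →
      (3 / 2) ^ N * (ξ ^ 2 * inner ℝ v m) ≤ 4 := by
    intro m hm hum hem hvm
    have h0 := h.growth_pow hu1 hv1 hu huv (by linarith) hm hum hem hvm N hn (by
      rcases hN with rfl | hN
      · simpa using h.clock_mono hn le_rfl
      · have a := h.time_le hu1 hv1 hu huv (by linarith) (j := 0) (by omega)
        have b := h.time_le hu1 hv1 hu huv (by linarith) (j := 1) (by omega)
        rw [clock_succ, clock_succ, clock_zero]; linarith)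
    have h1 := h.inner_pos_succ m (j := 0) (by omega)
    have h2 := h.inner_pos_succ m (j := 1) (by omega)
    rw [h.pos_zero, inner_smul_left, hum, mul_zero, zero_add, h.vel_zero, zero_add] at h1
    have h3 := h.inner_vel_succ hum hem hvm (j := 0) (by omega)
    rw [h.vel_zero, zero_add, h1] at h3
    have h4 := h.le_norm_vel_sub hu1 hv1 hu huv hξ (j := 0) (by omega)
    rw [h.vel_zero, zero_add] at h4
    have h5 := h.le_time_zero hu1 hv1 hu (by omega)
    have h6 := h.le_time hu1 hv1 hu huv (j := 1) (by omega)
    have p1 : 4 / 5 * ξ * inner ℝ v m ≤ τ 0 * inner ℝ v m :=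
      mul_le_mul_of_nonneg_right (by linarith) hvm
    have p2 : 0 ≤ 4 / 5 * ξ * inner ℝ v m := by positivity
    have p3 : 7 / 5 * (4 / 5 * ξ * inner ℝ v m) ≤ ‖w 1 - v‖ * (τ 0 * inner ℝ v m) :=
      mul_le_mul h4 p1 p2 (norm_nonneg _)
    have p4 : 3 / 5 * ξ * (7 / 5 * (4 / 5 * ξ * inner ℝ v m)) ≤ τ 1 * inner ℝ (w 1) m :=
      mul_le_mul (by linarith) (by linarith) (by positivity) (h.time_nonneg 1 (by omega))
    have p5 : ξ ^ 2 * inner ℝ v m / 2 ≤ inner ℝ (x (1 + 1)) m + inner ℝ (w (1 + 1)) m := by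
      have q1 := (h.transverse_nonneg hum hem hvm (j := 1) (by omega)).1
      have q2 := (h.transverse_nonneg hum hem hvm (j := 1 + 1) (by omega)).2
      have q3 : 0 ≤ ξ ^ 2 * inner ℝ v m := by positivity
      linarith
    have p6 := mul_le_mul_of_nonneg_left p5 (show (0 : ℝ) ≤ (3 / 2) ^ N by positivity)
    linarith
  rcases le_total 0 (inner ℝ v m) with h0 | h0
  · rw [abs_of_nonneg h0]
    exact key m hm hum hem h0
  · rw [abs_of_nonpos h0, ← inner_neg_right]
    exact key (-m) (by rwa [norm_neg]) (by rw [inner_neg_right, hum, neg_zero])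
      (by rw [inner_neg_right, hem, neg_zero]) (by rw [inner_neg_right]; linarith)

end IsOrbit

/-! ### Exponential growth as polynomial decay in the trapping time -/

/-- A fourth power is all that is kept of the exponential growth; it suffices for the O(s⁻²)
integral over ξ. -/
theorem pow_four_le (N : ℕ) : ((N : ℝ) + 3) ^ 4 ≤ 1000 * (3 / 2) ^ N := by
  rcases lt_or_ge N 7 with h | h
  · interval_cases N <;> norm_num
  induction N, h using Nat.le_induction with
  | base => norm_num
  | succ N hN ih =>
    have hN' : (7 : ℝ) ≤ N := by exact_mod_cast hN
    have : ((N : ℝ) + 1 + 3) ^ 4 ≤ 3 / 2 * ((N : ℝ) + 3) ^ 4 := by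
      have h1 : ((N : ℝ) + 1 + 3) ≤ 11 / 10 * (N + 3) := by linarith
      calc ((N : ℝ) + 1 + 3) ^ 4 ≤ (11 / 10 * (N + 3)) ^ 4 := by gcongr
        _ = (11 / 10) ^ 4 * ((N : ℝ) + 3) ^ 4 := by ring
        _ ≤ 3 / 2 * ((N : ℝ) + 3) ^ 4 := by gcongr; norm_num
    push_cast
    rw [pow_succ (3 / 2 : ℝ)]
    linarith

theorem exists_windows {D s t : ℝ} (hD : 0 < D) (hs : 0 ≤ s) (hst : s ≤ t) :
    ∃ N : ℕ, (N = 0 ∨ D * (N + 1) ≤ t) ∧ (1 + s / D) ^ 4 ≤ 1000 * (3 / 2) ^ N := by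
  have h0 : 0 ≤ s / D := by positivity
  -- Truncated subtraction: N = 0 when s/D < 2, and N + 3 ≥ 1 + s/D always.
  refine ⟨⌊s / D⌋₊ - 1, ?_, le_trans ?_ (pow_four_le _)⟩
  · rcases Nat.eq_zero_or_pos (⌊s / D⌋₊ - 1) with h | h
    · exact Or.inl h
    · right
      rw [Nat.cast_sub (by omega), Nat.cast_one, sub_add_cancel]
      have := Nat.floor_le h0
      rw [le_div_iff₀ hD] at this
      linarith
  · have h1 := Nat.lt_floor_add_one (s / D)
    have h2 : (⌊s / D⌋₊ : ℝ) ≤ ((⌊s / D⌋₊ - 1 : ℕ) : ℝ) + 1 := by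
      exact_mod_cast (by omega : ⌊s / D⌋₊ ≤ ⌊s / D⌋₊ - 1 + 1)
    exact pow_le_pow_left₀ (by positivity) (by linarith) 4

namespace IsOrbit

variable {u v : E3} {ξ s : ℝ} {n : ℕ} {τ : ℕ → ℝ} {x w : ℕ → E3}

theorem abs_inner_le_of_trapped_near (h : IsOrbit u ξ v n τ x w) (hu1 : ‖u‖ = 1) (hv1 : ‖v‖ = 1)
    (hu : u ≠ e) (huv : u ≠ v) (hξ : 0 < ξ) (hξ' : ξ ≤ 10) {m : E3} (hm : ‖m‖ = 1)
    (hum : inner ℝ u m = 0) (hem : inner ℝ e m = 0) (hs : 0 < s) (hsn : s ≤ clock ξ τ n) :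
    |inner ℝ v m| ≤ 4000000 / (1 + s ^ 2) := by
  obtain ⟨N, hN, hN'⟩ := exists_windows (D := 3 * (ξ + 4)) (by linarith) hs.le hsn
  have h1 := h.pow_mul_abs_inner_le hu1 hv1 hu huv hξ hm hum hem hN
  -- For ξ ≤ 10 the window is at most 42, and 1764 = 42².
  have h2 : (1 + s ^ 2) / 1764 ≤ (1 + s / (3 * (ξ + 4))) ^ 4 := by
    have a : s / 42 ≤ s / (3 * (ξ + 4)) := by gcongr; linarith
    calc (1 + s ^ 2) / 1764 ≤ (1 + s / 42) ^ 2 := by nlinarith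
      _ ≤ (1 + s / (3 * (ξ + 4))) ^ 2 := by gcongr
      _ ≤ (1 + s / (3 * (ξ + 4))) ^ 4 :=
        pow_le_pow_right₀ (by linarith [show 0 ≤ s / (3 * (ξ + 4)) by positivity]) (by norm_num)
  rw [le_div_iff₀ (by positivity)]
  have h3 := mul_le_mul_of_nonneg_right (h2.trans hN') (abs_nonneg (inner ℝ v m))
  linarith

theorem abs_inner_le_of_trapped_far (h : IsOrbit u ξ v n τ x w) (hu1 : ‖u‖ = 1) (hv1 : ‖v‖ = 1)
    (hu : u ≠ e) (huv : u ≠ v) (hξ : 10 ≤ ξ) (hn : 2 ≤ n) {m : E3} (hm : ‖m‖ = 1)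
    (hum : inner ℝ u m = 0) (hem : inner ℝ e m = 0) (hs : 0 < s) (hsn : s ≤ clock ξ τ n) :
    |inner ℝ v m| ≤ 2500000 * ξ ^ 2 / (ξ + s) ^ 4 := by
  obtain ⟨N, hN, hN'⟩ := exists_windows (D := 3 * (ξ + 4)) (by linarith) hs.le hsn
  have h1 := h.pow_mul_sq_mul_abs_inner_le hu1 hv1 hu huv hξ hn hm hum hem hN
  have hξ0 : 0 < ξ := by linarith
  have h2 : ((ξ + s) / (5 * ξ)) ^ 4 ≤ (1 + s / (3 * (ξ + 4))) ^ 4 := by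
    have a : s / (5 * ξ) ≤ s / (3 * (ξ + 4)) :=
      div_le_div_of_nonneg_left hs.le (by positivity) (by linarith)
    have b : ξ / (5 * ξ) ≤ 1 := by rw [div_le_one (by positivity)]; linarith
    rw [add_div]
    gcongr
  have h3 := mul_le_mul_of_nonneg_right (h2.trans hN')
    (show 0 ≤ ξ ^ 2 * |inner ℝ v m| by positivity)
  have h4 : ((ξ + s) / (5 * ξ)) ^ 4 * (ξ ^ 2 * |inner ℝ v m|) =
      (ξ + s) ^ 4 * |inner ℝ v m| / (625 * ξ ^ 2) := by
    field_simp
    ring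
  rw [h4] at h3
  have h5 : (ξ + s) ^ 4 * |inner ℝ v m| / (625 * ξ ^ 2) ≤ 4000 := by linarith
  rw [div_le_iff₀ (by positivity)] at h5
  rw [le_div_iff₀ (by positivity)]
  linarith

end IsOrbit

/-- Every unit vector `u` and vector `f` admit an orthonormal basis whose last vector is orthogonal
to both and whose middle vector is orthogonal to `u`. -/
theorem exists_frame {u : E3} (hu : ‖u‖ = 1) (f : E3) : ∃ b : OrthonormalBasis (Fin 3) ℝ E3,
    inner ℝ u (b 1) = 0 ∧ inner ℝ u (b 2) = 0 ∧ inner ℝ f (b 2) = 0 := by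
  set K : Submodule ℝ E3 := Submodule.span ℝ {u, f} with hK
  have h1 : Module.finrank ℝ K ≤ 2 := by
    classical
    have := finrank_span_finset_le_card (R := ℝ) ({u, f} : Finset E3)
    rw [Finset.coe_pair] at this
    exact this.trans Finset.card_le_two
  have h2 : Kᗮ ≠ ⊥ := by
    intro h
    have h3 := K.finrank_add_finrank_orthogonal
    rw [h, finrank_bot, finrank_euclideanSpace, Fintype.card_fin] at h3
    omega
  obtain ⟨m, hm, hm0⟩ := Submodule.exists_mem_ne_zero_of_ne_bot h2
  have hum : inner ℝ u (‖m‖⁻¹ • m) = 0 := by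
    rw [inner_smul_right, Submodule.inner_right_of_mem_orthogonal
      (Submodule.subset_span (by simp)) hm, mul_zero]
  have hfm : inner ℝ f (‖m‖⁻¹ • m) = 0 := by
    rw [inner_smul_right, Submodule.inner_right_of_mem_orthogonal
      (Submodule.subset_span (by simp)) hm, mul_zero]
  have ho : Orthonormal ℝ ((({0, 2} : Set (Fin 3))).domRestrict ![u, 0, ‖m‖⁻¹ • m]) := by
    rw [orthonormal_iff_ite]
    rintro ⟨i, rfl | rfl⟩ ⟨j, rfl | rfl⟩
    · simp [hu]
    · simpa [Subtype.ext_iff] using hum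
    · simpa [Subtype.ext_iff, real_inner_comm] using hum
    · simp [norm_smul, hm0]
  obtain ⟨b, hb⟩ := ho.exists_orthonormalBasis_extension_of_card_eq (by simp)
  have b0 : b 0 = u := by simpa using hb 0 (by simp)
  have b2 : b 2 = ‖m‖⁻¹ • m := by simpa using hb 2 (by simp)
  refine ⟨b, ?_, by rw [b2, hum], by rw [b2, hfm]⟩
  rw [← b0]
  exact b.orthonormal.2 (by decide)

/-! ### Measures of boxes on the sphere, and slicing -/

theorem volume_box_le (b : OrthonormalBasis (Fin 3) ℝ E3) (c : Fin 3 → ℝ) :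
    volume {x : E3 | ∀ i, |inner ℝ x (b i)| ≤ c i} ≤ ∏ i, ENNReal.ofReal (2 * c i) := by
  have h1 : {x : E3 | ∀ i, |inner ℝ x (b i)| ≤ c i} =
      (fun x => (MeasurableEquiv.toLp 2 (Fin 3 → ℝ)).symm (b.repr x)) ⁻¹'
        Set.Icc (fun i => -c i) c := by
    ext x
    simp only [Set.mem_ofPred_eq, Set.mem_preimage, Set.mem_Icc, Pi.le_def, ← forall_and, abs_le]
    refine forall_congr' fun i => ?_
    rw [real_inner_comm, ← b.repr_apply_apply]
    rfl
  have h2 := (EuclideanSpace.volume_preserving_symm_measurableEquiv_toLp (Fin 3)).comp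
    b.measurePreserving_repr
  rw [h1]
  refine (h2.measure_preimage measurableSet_Icc.nullMeasurableSet).le.trans ?_
  rw [Real.volume_Icc_pi]
  refine le_of_eq (Finset.prod_congr rfl fun i _ => ?_)
  congr 1
  ring

theorem norm_coe_S2 (v : S2) : ‖(v : E3)‖ = 1 := by simp

theorem toSphere_univ_eq :
    (volume : Measure E3).toSphere Set.univ = ENNReal.ofReal (4 * Real.pi) := by
  rw [Measure.toSphere_apply_univ, EuclideanSpace.volume_ball_fin_three, finrank_euclideanSpace,
    Fintype.card_fin, ENNReal.ofReal_one, one_pow, one_mul, ← ENNReal.ofReal_natCast,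
    ← ENNReal.ofReal_mul (by positivity)]
  congr 1
  push_cast
  ring

instance : IsProbabilityMeasure uniS2 := by
  constructor
  rw [uniS2, Measure.smul_apply, smul_eq_mul, toSphere_univ_eq]
  exact ENNReal.inv_mul_cancel (by simpa using Real.pi_pos) ENNReal.ofReal_ne_top

/-- `toSphere` is three times the volume of the cone over the set. The cone lies in a box of volume
8αβ, and 3·8/(4π) < 2. -/
theorem uniS2_box_le (b : OrthonormalBasis (Fin 3) ℝ E3) {α β : ℝ} (hα : 0 ≤ α) (hβ : 0 ≤ β) :
    uniS2 {v : S2 | |inner ℝ (v : E3) (b 2)| ≤ α ∧ |inner ℝ (v : E3) (b 1)| ≤ β} ≤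
      ENNReal.ofReal (2 * α * β) := by
  have hmeas : MeasurableSet
      {v : S2 | |inner ℝ (v : E3) (b 2)| ≤ α ∧ |inner ℝ (v : E3) (b 1)| ≤ β} := by
    have key : ∀ i β, MeasurableSet {v : S2 | |inner ℝ (v : E3) (b i)| ≤ β} := fun i β =>
      (isClosed_le (f := fun v : S2 => |inner ℝ (v : E3) (b i)|) (by fun_prop)
        continuous_const).measurableSet
    exact (key 2 α).inter (key 1 β)
  rw [uniS2, Measure.smul_apply, smul_eq_mul, Measure.toSphere_apply' _ hmeas, toSphere_univ_eq,
    finrank_euclideanSpace, Fintype.card_fin]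
  have h1 : volume (Set.Ioo (0 : ℝ) 1 • (Subtype.val '' {v : S2 |
      |inner ℝ (v : E3) (b 2)| ≤ α ∧ |inner ℝ (v : E3) (b 1)| ≤ β})) ≤
      ENNReal.ofReal (8 * α * β) := by
    refine (measure_mono ?_).trans ((volume_box_le b ![1, β, α]).trans ?_)
    · rintro _ ⟨t, ⟨ht0, ht1⟩, _, ⟨v, ⟨hv1, hv2⟩, rfl⟩, rfl⟩ i
      have key : ∀ i, |inner ℝ (t • (v : E3)) (b i)| ≤ |inner ℝ (v : E3) (b i)| := by
        intro i
        rw [real_inner_smul_left, abs_mul, abs_of_pos ht0]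
        exact mul_le_of_le_one_left (abs_nonneg _) ht1.le
      refine (key i).trans ?_
      fin_cases i
      · simpa [norm_coe_S2] using abs_inner_le_of_norm_eq_one (x := (v : E3)) (b.norm_eq_one 0)
      · exact hv2
      · exact hv1
    · simp only [Fin.prod_univ_three]
      rw [← ENNReal.ofReal_mul (by simp), ← ENNReal.ofReal_mul (by simp; positivity)]
      apply ENNReal.ofReal_le_ofReal
      simp
      linarith
  calc (ENNReal.ofReal (4 * Real.pi))⁻¹ * ((3 : ℕ) * _)
      ≤ (ENNReal.ofReal (4 * Real.pi))⁻¹ * ((3 : ℕ) * ENNReal.ofReal (8 * α * β)) := by gcongr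
    _ = ENNReal.ofReal ((4 * Real.pi)⁻¹ * (3 * (8 * α * β))) := by
      rw [← ENNReal.ofReal_natCast, ← ENNReal.ofReal_mul (by positivity),
        ← ENNReal.ofReal_inv_of_pos (by positivity), ← ENNReal.ofReal_mul (by positivity)]
      norm_num
    _ ≤ ENNReal.ofReal (2 * α * β) := by
      apply ENNReal.ofReal_le_ofReal
      rw [inv_mul_le_iff₀ (by positivity)]
      nlinarith [Real.pi_gt_three, mul_nonneg hα hβ]

theorem uniS2_strip_le (b : OrthonormalBasis (Fin 3) ℝ E3) {α : ℝ} (hα : 0 ≤ α) :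
    uniS2 {v : S2 | |inner ℝ (v : E3) (b 2)| ≤ α} ≤ ENNReal.ofReal (2 * α) := by
  refine (measure_mono fun v hv => ?_).trans ((uniS2_box_le b hα zero_le_one).trans (by rw [mul_one]))
  exact ⟨hv, by simpa [norm_coe_S2] using
    abs_inner_le_of_norm_eq_one (x := (v : E3)) (b.norm_eq_one 1)⟩

theorem uniS2_le_of_dist_le {T : Set S2} {ρ : ℝ} (hρ : 0 ≤ ρ)
    (hT : ∀ v ∈ T, ∀ v' ∈ T, ‖(v : E3) - v'‖ ≤ ρ) : uniS2 T ≤ ENNReal.ofReal (2 * ρ ^ 2) := by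
  rcases T.eq_empty_or_nonempty with rfl | ⟨v₀, hv₀⟩
  · simp
  obtain ⟨b, h1, h2, -⟩ := exists_frame (norm_coe_S2 v₀) 0
  refine (measure_mono fun v hv => ?_).trans
    ((uniS2_box_le b hρ hρ).trans (by rw [sq, mul_assoc]))
  have key : ∀ i, inner ℝ (v₀ : E3) (b i) = 0 → |inner ℝ (v : E3) (b i)| ≤ ρ := by
    intro i hi
    have := abs_inner_le_of_norm_eq_one (x := (v : E3) - v₀) (b.norm_eq_one i)
    rw [inner_sub_left, hi, sub_zero] at this
    exact this.trans (hT v hv v₀ hv₀)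
  exact ⟨key 2 h2, key 1 h1⟩

theorem uniS2_singleton (v : S2) : uniS2 {v} = 0 := by
  have := uniS2_le_of_dist_le (T := {v}) le_rfl (by rintro _ rfl _ rfl; simp)
  simpa using this

theorem expCond_le : expCond ≤ (2 : ENNReal) • volume.restrict (Set.Icc 0 1) := by
  have h : (2 : ENNReal) • (volume : Measure ℝ).restrict (Set.Icc 0 1) =
      volume.withDensity ((Set.Icc (0 : ℝ) 1).indicator fun _ => 2) := by
    rw [withDensity_indicator measurableSet_Icc, withDensity_const]
  rw [h, expCond]
  refine withDensity_mono (Filter.Eventually.of_forall fun x => ?_)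
  by_cases hx : x ∈ Set.Icc (0 : ℝ) 1
  · simp only [Set.indicator_of_mem hx]
    rw [← ENNReal.ofReal_ofNat]
    apply ENNReal.ofReal_le_ofReal
    have h1 : (2.7 : ℝ) < Real.exp 1 := by have := Real.exp_one_gt_d9; linarith
    have h2 : Real.exp (1 - x) ≤ Real.exp 1 := Real.exp_le_exp.2 (by linarith [hx.1])
    rw [div_le_iff₀ (by linarith)]
    linarith
  · simp [Set.indicator_of_notMem hx]

/-- Integration over slices: in units of `r`, the density of the free flight is at most `2 r`. -/
theorem mu_le_of_slices {r K : ℝ} (hr : 0 < r) {S : Set (S2 × ℝ × S2)} {G : Set (S2 × ℝ × S2)}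
    (hG : MeasurableSet G) {g : ℝ → ℝ} (hg : Measurable g)
    (hS : ∀ p ∈ S, (p.1 : E3) ≠ e → 0 < p.2.1 ∧ (p.1, p.2.1 / r, p.2.2) ∈ G)
    (hslice : ∀ u : S2, (u : E3) ≠ e → ∀ ξ : ℝ, 0 < ξ →
      uniS2 {v | (u, ξ, v) ∈ G} ≤ ENNReal.ofReal (g ξ))
    (hK : ∫⁻ ξ in Set.Ioi 0, ENNReal.ofReal (g ξ) ≤ ENNReal.ofReal K) :
    mu S ≤ ENNReal.ofReal (2 * r * K) := by
  set e' : S2 := ⟨e, by simp [norm_e]⟩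
  set Φ : S2 × ℝ × S2 → S2 × ℝ × S2 := fun p => (p.1, p.2.1 / r, p.2.2)
  have hΦ : Measurable Φ := by fun_prop
  -- `S` need not be measurable: it is covered by a measurable set and the null set u = e.
  set G' : Set (S2 × ℝ × S2) := (Φ ⁻¹' G) ∩ {p | p.1 ≠ e' ∧ 0 < p.2.1}
  have hG' : MeasurableSet G' := by
    refine (hΦ hG).inter (MeasurableSet.inter ?_ ?_)
    · exact (measurableSet_singleton e').compl.preimage measurable_fst
    · exact measurableSet_lt (f := fun _ => (0 : ℝ)) (g := fun p : S2 × ℝ × S2 => p.2.1)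
        measurable_const (by fun_prop)
  have : IsFiniteMeasure ((2 : ENNReal) • (volume : Measure ℝ).restrict (Set.Icc 0 1)) :=
    Measure.smul_finite _ (by simp)
  have : IsFiniteMeasure expCond := isFiniteMeasure_of_le _ expCond_le
  have h1 : S ⊆ G' ∪ ({e'} ×ˢ Set.univ) := by
    intro p hp
    by_cases he : p.1 = e'
    · exact Or.inr ⟨he, trivial⟩
    · have he' : (p.1 : E3) ≠ e := fun h => he (Subtype.ext h)
      exact Or.inl ⟨(hS p hp he').2, he, (hS p hp he').1⟩
  have h2 : mu ({e'} ×ˢ Set.univ) = 0 := by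
    rw [mu, Measure.prod_prod, uniS2_singleton, zero_mul]
  have h3 : ∀ u : S2, (expCond.prod uniS2) (Prod.mk u ⁻¹' G') ≤ ENNReal.ofReal (2 * r * K) := by
    intro u
    rw [Measure.prod_apply (measurable_prodMk_left hG')]
    have hb : ∀ h : ℝ, uniS2 (Prod.mk h ⁻¹' (Prod.mk u ⁻¹' G')) ≤
        (Set.Ioi (0 : ℝ)).indicator (fun h => ENNReal.ofReal (g (h / r))) h := by
      intro h
      by_cases hu : u ≠ e' ∧ 0 < h
      · rw [Set.indicator_of_mem (show h ∈ Set.Ioi (0 : ℝ) from hu.2)]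
        refine (measure_mono ?_).trans
          (hslice u (fun h => hu.1 (Subtype.ext h)) (h / r) (div_pos hu.2 hr))
        rintro v ⟨hv, -⟩
        exact hv
      · have : Prod.mk h ⁻¹' (Prod.mk u ⁻¹' G') = ∅ := by
          ext v
          simp only [Set.mem_preimage, Set.mem_empty_iff_false, iff_false]
          rintro ⟨-, hv⟩
          exact hu hv
        rw [this, measure_empty]
        exact zero_le
    have hgm : Measurable fun h => ENNReal.ofReal (g (h / r)) := by fun_prop
    calc ∫⁻ h, uniS2 (Prod.mk h ⁻¹' (Prod.mk u ⁻¹' G')) ∂expCond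
        ≤ ∫⁻ h, (Set.Ioi (0 : ℝ)).indicator (fun h => ENNReal.ofReal (g (h / r))) h ∂expCond :=
          lintegral_mono hb
      _ ≤ ∫⁻ h, (Set.Ioi (0 : ℝ)).indicator (fun h => ENNReal.ofReal (g (h / r))) h
            ∂((2 : ENNReal) • (volume : Measure ℝ)) :=
          lintegral_mono' (expCond_le.trans (by gcongr; exact Measure.restrict_le_self)) le_rfl
      _ = 2 * ∫⁻ h in Set.Ioi 0, ENNReal.ofReal (g (h / r)) := by
          rw [lintegral_smul_measure, smul_eq_mul, lintegral_indicator measurableSet_Ioi]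
      _ = 2 * (ENNReal.ofReal r * ∫⁻ ξ in Set.Ioi 0, ENNReal.ofReal (g ξ)) := by
          congr 1
          have := lintegral_image_eq_lintegral_abs_deriv_mul (s := Set.Ioi (0 : ℝ))
            (f := fun ξ => r * ξ) (f' := fun _ => r) measurableSet_Ioi
            (fun x _ => by simpa using ((hasDerivAt_id x).const_mul r).hasDerivWithinAt)
            (mul_right_injective₀ hr.ne').injOn (fun h => ENNReal.ofReal (g (h / r)))
          rw [Set.image_mul_left_Ioi hr, mul_zero] at this
          rw [this, abs_of_pos hr, lintegral_const_mul' _ _ ENNReal.ofReal_ne_top]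
          congr 1
          refine lintegral_congr fun ξ => ?_
          rw [mul_div_cancel_left₀ _ hr.ne']
      _ ≤ 2 * (ENNReal.ofReal r * ENNReal.ofReal K) := by gcongr
      _ = ENNReal.ofReal (2 * r * K) := by
          rw [← ENNReal.ofReal_mul hr.le, ← ENNReal.ofReal_ofNat,
            ← ENNReal.ofReal_mul (by norm_num), mul_assoc]
  calc mu S ≤ mu (G' ∪ ({e'} ×ˢ Set.univ)) := measure_mono h1
    _ ≤ mu G' + mu ({e'} ×ˢ Set.univ) := measure_union_le _ _
    _ = ∫⁻ u, (expCond.prod uniS2) (Prod.mk u ⁻¹' G') ∂uniS2 := by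
      rw [h2, add_zero, mu, Measure.prod_apply hG']
    _ ≤ ∫⁻ _, ENNReal.ofReal (2 * r * K) ∂uniS2 := lintegral_mono h3
    _ = ENNReal.ofReal (2 * r * K) := by simp

/-! ### The flight time to a unit ball -/

/-- Explicit flight time to the unit ball centred at `c`. -/
noncomputable def flightTime (c x w : E3) : ℝ :=
  -inner ℝ w (x - c) - √(inner ℝ w (x - c) ^ 2 - (‖x - c‖ ^ 2 - 1))

theorem norm_flight_sq {c x w : E3} (hw : ‖w‖ = 1) (t : ℝ) :
    ‖x + t • w - c‖ ^ 2 =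
      (t + inner ℝ w (x - c)) ^ 2 - (inner ℝ w (x - c) ^ 2 - (‖x - c‖ ^ 2 - 1)) + 1 := by
  rw [add_sub_right_comm, norm_add_sq_real, norm_smul, hw, inner_smul_right, mul_one,
    Real.norm_eq_abs, sq_abs, real_inner_comm]
  ring

theorem not_hits_of_outgoing {c x w : E3} (hw : ‖w‖ = 1) (hx : 1 ≤ ‖x - c‖)
    (ho : 0 ≤ inner ℝ w (x - c)) : ¬ Hits 1 c x w := by
  rintro ⟨t, ht, h⟩
  have h1 := norm_flight_sq (c := c) (x := x) hw t
  nlinarith [norm_nonneg (x + t • w - c), mul_nonneg ht.le ho]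

/-- A line that meets the ball at positive times from a point not inside it must point inward, so
both roots of the quadratic are nonnegative and the constraint t > 0 is automatic. -/
theorem insideTimes_eq_Ioo {c x w : E3} (hw : ‖w‖ = 1) (hx : 1 ≤ ‖x - c‖) (hh : Hits 1 c x w) :
    0 ≤ flightTime c x w ∧ 0 < inner ℝ w (x - c) ^ 2 - (‖x - c‖ ^ 2 - 1) ∧
      insideTimes 1 c x w = Set.Ioo (flightTime c x w)
        (-inner ℝ w (x - c) + √(inner ℝ w (x - c) ^ 2 - (‖x - c‖ ^ 2 - 1))) := by
  have hneg : inner ℝ w (x - c) < 0 := by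
    by_contra! h
    exact not_hits_of_outgoing hw hx h hh
  have key : ∀ t, ‖x + t • w - c‖ < 1 ↔
      (t + inner ℝ w (x - c)) ^ 2 < inner ℝ w (x - c) ^ 2 - (‖x - c‖ ^ 2 - 1) := by
    intro t
    have h1 := norm_flight_sq (c := c) (x := x) hw t
    rw [← sq_lt_one_iff₀ (norm_nonneg _), h1]
    constructor <;> intro h <;> linarith
  have hpos : 0 ≤ flightTime c x w := by
    rw [flightTime, sub_nonneg]
    apply Real.sqrt_le_iff.2
    constructor
    · linarith
    · nlinarith
  refine ⟨hpos, ?_, ?_⟩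
  · obtain ⟨t, -, h⟩ := hh
    exact (sq_nonneg _).trans_lt ((key t).1 h)
  · ext t
    have h2 : t ∈ insideTimes 1 c x w ↔ 0 < t ∧ ‖x + t • w - c‖ < 1 := Iff.rfl
    rw [h2, key, Real.sq_lt, Set.mem_Ioo]
    unfold flightTime at hpos ⊢
    constructor
    · rintro ⟨-, h3, h4⟩
      constructor <;> linarith
    · rintro ⟨h3, h4⟩
      refine ⟨by linarith, by linarith, by linarith⟩

theorem hitTime_eq {c x w : E3} (hw : ‖w‖ = 1) (hx : 1 ≤ ‖x - c‖) (hh : Hits 1 c x w) :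
    hitTime 1 c x w = flightTime c x w := by
  obtain ⟨-, h2, h3⟩ := insideTimes_eq_Ioo hw hx hh
  rw [hitTime, h3, csInf_Ioo]
  rw [flightTime]
  linarith [Real.sqrt_pos.2 h2]

theorem flight_to_sphere {c x w : E3} (hw : ‖w‖ = 1) (hx : 1 ≤ ‖x - c‖) (hh : Hits 1 c x w) :
    0 ≤ flightTime c x w ∧ ‖x + flightTime c x w • w - c‖ = 1 ∧
      inner ℝ w (x + flightTime c x w • w - c) ≤ 0 := by
  obtain ⟨h1, h2, -⟩ := insideTimes_eq_Ioo hw hx hh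
  refine ⟨h1, ?_, ?_⟩
  · rw [← pow_eq_one_iff_of_nonneg (norm_nonneg _) two_ne_zero, norm_flight_sq hw]
    have h3 : (flightTime c x w + inner ℝ w (x - c)) ^ 2 =
        inner ℝ w (x - c) ^ 2 - (‖x - c‖ ^ 2 - 1) := by
      rw [flightTime]
      linear_combination Real.sq_sqrt h2.le
    rw [h3]; ring
  · rw [add_sub_right_comm, inner_add_right, inner_smul_right, real_inner_self_eq_norm_sq, hw,
      flightTime]
    linarith [Real.sqrt_nonneg (inner ℝ w (x - c) ^ 2 - (‖x - c‖ ^ 2 - 1))]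

/-! ### Scaling -/

theorem insideTimes_smul {r : ℝ} (hr : 0 < r) (c x w : E3) :
    insideTimes r (r • c) (r • x) w = r • insideTimes 1 c x w := by
  ext t
  rw [Set.mem_smul_set_iff_inv_smul_mem₀ hr.ne']
  have h1 : r • x + t • w - r • c = r • (x + (r⁻¹ • t) • w - c) := by
    rw [smul_sub, smul_add, smul_smul r, smul_eq_mul, mul_inv_cancel_left₀ hr.ne']
  have h2 : t ∈ insideTimes r (r • c) (r • x) w ↔ 0 < t ∧ ‖r • x + t • w - r • c‖ < r := Iff.rfl
  have h3 : r⁻¹ • t ∈ insideTimes 1 c x w ↔ 0 < r⁻¹ • t ∧ ‖x + (r⁻¹ • t) • w - c‖ < 1 := Iff.rfl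
  rw [h2, h3, h1, norm_smul, Real.norm_of_nonneg hr.le, mul_lt_iff_lt_one_right hr, smul_eq_mul,
    mul_pos_iff_of_pos_left (inv_pos.2 hr)]

theorem hits_smul_iff {r : ℝ} (hr : 0 < r) (c x w : E3) :
    Hits r (r • c) (r • x) w ↔ Hits 1 c x w := by
  rw [Hits, Hits, insideTimes_smul hr, Set.smul_set_nonempty]

theorem hitTime_smul {r : ℝ} (hr : 0 < r) (c x w : E3) :
    hitTime r (r • c) (r • x) w = r * hitTime 1 c x w := by
  rw [hitTime, hitTime, insideTimes_smul hr, Real.sInf_smul_of_nonneg hr.le, smul_eq_mul]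

theorem centerA_eq_smul (r : ℝ) (u : E3) : centerA r u = r • centerA 1 u := by
  simp [centerA]

theorem centerB_eq_smul {r : ℝ} (hr : 0 < r) (u v : E3) (h : ℝ) :
    centerB r u h v = r • centerB 1 u (h / r) v := by
  rw [centerB, centerB, one_smul, smul_add, smul_smul r (h / r), mul_div_cancel₀ _ hr.ne']

theorem reflect_smul {r : ℝ} (hr : 0 < r) (c x w : E3) :
    reflect r (r • c) (r • x) w = w - (2 * inner ℝ w (x - c)) • (x - c) := by
  rw [reflect, ← smul_sub, inv_smul_smul₀ hr.ne']

theorem collide_smul {r : ℝ} (hr : 0 < r) {c x w : E3} (hw : ‖w‖ = 1) (hx : 1 ≤ ‖x - c‖)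
    (hh : Hits 1 c x w) (s : ℝ) :
    collide r (r • c) ⟨s, r • x, w⟩ = ⟨s + r * flightTime c x w, r • (x + flightTime c x w • w),
      w - (2 * inner ℝ w (x + flightTime c x w • w - c)) • (x + flightTime c x w • w - c)⟩ := by
  have h1 : r • x + (r * flightTime c x w) • w = r • (x + flightTime c x w • w) := by
    rw [smul_add, smul_smul]
  simp only [collide, hitTime_smul hr, hitTime_eq hw hx hh, h1, reflect_smul hr]

/-! ### The orbit as an explicit function of the initial data -/

/-- Position and velocity after `j` further collisions. -/
noncomputable def orb (u : E3) (ξ : ℝ) (v : E3) : ℕ → E3 × E3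
  | 0 => (ξ • u, v)
  | j + 1 =>
    let c := ctr u ξ v (j + 1)
    let x := (orb u ξ v j).1
    let w := (orb u ξ v j).2
    let y := x + flightTime c x w • w
    (y, w - (2 * inner ℝ w (y - c)) • (y - c))

/-- The flight time after `j` further collisions. -/
noncomputable def orbTime (u : E3) (ξ : ℝ) (v : E3) (j : ℕ) : ℝ :=
  flightTime (ctr u ξ v (j + 1)) (orb u ξ v j).1 (orb u ξ v j).2

/-- There are at least `n` further collisions. -/
def HasOrbit (u : E3) (ξ : ℝ) (v : E3) (n : ℕ) : Prop :=
  IsOrbit u ξ v n (orbTime u ξ v) (fun j => (orb u ξ v j).1) (fun j => (orb u ξ v j).2)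

/-- The other clauses of `IsOrbit` hold by definition of `orb`; the remaining ones are visibly
measurable conditions. -/
theorem hasOrbit_iff {u : E3} {ξ : ℝ} {v : E3} {n : ℕ} : HasOrbit u ξ v n ↔ ∀ j < n,
    0 ≤ orbTime u ξ v j ∧ ‖(orb u ξ v (j + 1)).1 - ctr u ξ v (j + 1)‖ = 1 ∧
      inner ℝ (orb u ξ v j).2 ((orb u ξ v (j + 1)).1 - ctr u ξ v (j + 1)) ≤ 0 := by
  constructor
  · intro h j hj
    exact ⟨h.time_nonneg j hj, h.sphere j hj, h.incoming j hj⟩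
  · intro h
    exact ⟨rfl, rfl, fun _ _ => rfl, fun j hj => (h j hj).1, fun j hj => (h j hj).2.1,
      fun j hj => (h j hj).2.2, fun _ _ => rfl⟩

theorem measurable_ctr (j : ℕ) :
    Measurable fun p : S2 × ℝ × S2 => ctr (p.1 : E3) p.2.1 p.2.2 j := by
  unfold ctr
  split_ifs
  · unfold centerA; fun_prop
  · unfold centerB; fun_prop

theorem _root_.Measurable.flightTime {α : Type*} [MeasurableSpace α] {c x w : α → E3}
    (hc : Measurable c) (hx : Measurable x) (hw : Measurable w) :
    Measurable fun a => Lorentz.flightTime (c a) (x a) (w a) := by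
  unfold Lorentz.flightTime; fun_prop

theorem measurable_orb (j : ℕ) :
    Measurable fun p : S2 × ℝ × S2 => orb (p.1 : E3) p.2.1 p.2.2 j := by
  induction j with
  | zero => unfold orb; fun_prop
  | succ j ih =>
    have hc := measurable_ctr (j + 1)
    have ht := hc.flightTime ih.fst ih.snd
    have hy := ih.fst.add (ht.smul ih.snd)
    have hn := hy.sub hc
    exact hy.prodMk (ih.snd.sub ((Measurable.const_mul (Measurable.inner (𝕜 := ℝ) ih.snd hn) 2).smul hn))

theorem measurable_orbTime (j : ℕ) :
    Measurable fun p : S2 × ℝ × S2 => orbTime (p.1 : E3) p.2.1 p.2.2 j :=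
  (measurable_ctr (j + 1)).flightTime (measurable_orb j).fst (measurable_orb j).snd

theorem measurable_clock (j : ℕ) : Measurable fun p : S2 × ℝ × S2 =>
    clock p.2.1 (orbTime (p.1 : E3) p.2.1 p.2.2) j := by
  unfold clock
  have := measurable_orbTime
  fun_prop

theorem measurableSet_hasOrbit (n : ℕ) :
    MeasurableSet {p : S2 × ℝ × S2 | HasOrbit (p.1 : E3) p.2.1 p.2.2 n} := by
  simp only [hasOrbit_iff]
  refine measurableSet_setOfPred.2 (Measurable.forall fun j => Measurable.forall fun _ =>
    Measurable.and ?_ (Measurable.and ?_ ?_))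
  · exact measurableSet_setOfPred.1 (measurableSet_le measurable_const (measurable_orbTime j))
  · exact measurableSet_setOfPred.1 (measurableSet_eq_fun
      ((measurable_orb (j + 1)).fst.sub (measurable_ctr (j + 1))).norm measurable_const)
  · exact measurableSet_setOfPred.1 (measurableSet_le ((measurable_orb j).snd.inner
      ((measurable_orb (j + 1)).fst.sub (measurable_ctr (j + 1)))) measurable_const)

theorem ctr_add_two (u : E3) (ξ : ℝ) (v : E3) (j : ℕ) : ctr u ξ v (j + 2) = ctr u ξ v j := by
  simp [ctr, Nat.odd_add]

/-- `σ` is the state of the particle after `j` further collisions with scatterers of radius `r`. -/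
structure Tracks (r : ℝ) (u : E3) (ξ : ℝ) (v : E3) (j : ℕ) (σ : State) : Prop where
  eq : σ = ⟨r * clock ξ (orbTime u ξ v) j, r • (orb u ξ v j).1, (orb u ξ v j).2⟩
  orbit : HasOrbit u ξ v j
  norm_vel : ‖(orb u ξ v j).2‖ = 1
  outside : 1 ≤ ‖(orb u ξ v j).1 - ctr u ξ v j‖
  outside_succ : 1 ≤ ‖(orb u ξ v j).1 - ctr u ξ v (j + 1)‖
  outgoing : 0 ≤ inner ℝ (orb u ξ v j).2 ((orb u ξ v j).1 - ctr u ξ v j)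

theorem inner_normalize_sub_nonneg {u v : E3} (hu : ‖u‖ = 1) (hv : ‖v‖ = 1) :
    0 ≤ inner ℝ u (‖u - v‖⁻¹ • (u - v)) := by
  rw [inner_smul_right, inner_sub_right, real_inner_self_eq_norm_sq, hu]
  have : inner ℝ u v ≤ 1 := by simpa [hu, hv] using real_inner_le_norm u v
  have h1 : (0 : ℝ) ≤ 1 ^ 2 - inner ℝ u v := by linarith
  positivity

theorem one_le_norm_smul_add {u n : E3} {t : ℝ} (hn : ‖n‖ = 1) (ht : 0 ≤ t)
    (hun : 0 ≤ inner ℝ u n) : 1 ≤ ‖t • u + n‖ := by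
  have h := norm_add_sq_real (t • u) n
  rw [hn, real_inner_smul_left] at h
  have := mul_nonneg ht hun
  nlinarith [norm_nonneg (t • u + n), sq_nonneg ‖t • u‖]

section Dynamics

variable {r h ξ : ℝ} {u v : E3}

theorem tracks_zero (hr : 0 < r) (hu1 : ‖u‖ = 1) (hv1 : ‖v‖ = 1) (hu : u ≠ e) (huv : u ≠ v)
    (hh : 0 < h) : Tracks r u (h / r) v 0 ⟨h, h • u, v⟩ where
  eq := by
    rw [clock_zero, orb, smul_smul, mul_div_cancel₀ _ hr.ne']
  orbit := hasOrbit_iff.2 fun _ hj => absurd hj (Nat.not_lt_zero _)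
  norm_vel := hv1
  outside := by
    rw [norm_sub_rev]
    simp [orb, ctr, norm_centerB_sub huv]
  outside_succ := by
    have h1 : (orb u (h / r) v 0).1 - ctr u (h / r) v (0 + 1) =
        (h / r) • u + ‖u - e‖⁻¹ • (u - e) := by
      simp only [orb, ctr, zero_add, odd_one, if_true, centerA, one_smul]
      rw [norm_sub_rev e u, sub_eq_add_neg, ← smul_neg, neg_sub]
    rw [h1]
    exact one_le_norm_smul_add (norm_inv_norm_smul (sub_ne_zero.2 hu)) (div_pos hh hr).le
      (inner_normalize_sub_nonneg hu1 norm_e)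
  outgoing := by
    have h1 : (orb u (h / r) v 0).1 - ctr u (h / r) v 0 = ‖v - u‖⁻¹ • (v - u) := by
      have : ¬ Odd 0 := by decide
      simp only [orb, ctr, this, if_false, centerB, one_smul]
      rw [sub_add_cancel_left, ← smul_neg, neg_sub, norm_sub_rev]
    rw [h1]
    exact inner_normalize_sub_nonneg hv1 hu1

theorem nextCollision_eq_some {a b : E3} {σ σ' : State} (h : nextCollision r a b σ = some σ') :
    (Hits r a σ.pos σ.vel ∧ σ' = collide r a σ) ∨ (Hits r b σ.pos σ.vel ∧ σ' = collide r b σ) := by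
  unfold nextCollision at h
  split_ifs at h with h1 h2
  · exact Or.inl ⟨h1.1, (Option.some.inj h).symm⟩
  · exact Or.inr ⟨h2, (Option.some.inj h).symm⟩

/-- A particle leaving a ball outward cannot hit the same convex ball again, so the next collision
is with the other one. -/
theorem Tracks.next {j : ℕ} {σ σ' : State} (hT : Tracks r u (h / r) v j σ) (hr : 0 < r)
    (hn : nextCollision r (centerA r u) (centerB r u h v) σ = some σ') :
    Tracks r u (h / r) v (j + 1) σ' := by
  set ξ := h / r with hξ
  have hnot : ¬ Hits 1 (ctr u ξ v j) (orb u ξ v j).1 (orb u ξ v j).2 :=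
    not_hits_of_outgoing hT.norm_vel hT.outside hT.outgoing
  have hnot' : ¬ Hits r (r • ctr u ξ v j) σ.pos σ.vel := by
    rw [hT.eq]; simpa only [hits_smul_iff hr] using hnot
  have hstep : Hits r (r • ctr u ξ v (j + 1)) σ.pos σ.vel ∧
      σ' = collide r (r • ctr u ξ v (j + 1)) σ := by
    rw [centerA_eq_smul, centerB_eq_smul hr, ← hξ] at hn
    rcases Nat.even_or_odd j with ej | oj
    · have o : Odd (j + 1) := ej.add_one
      have o' : ¬ Odd j := Nat.not_odd_iff_even.2 ej
      rw [ctr, if_pos o]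
      rw [ctr, if_neg o'] at hnot'
      exact (nextCollision_eq_some hn).resolve_right fun h => hnot' h.1
    · have o : ¬ Odd (j + 1) := Nat.not_odd_iff_even.2 oj.add_one
      rw [ctr, if_neg o]
      rw [ctr, if_pos oj] at hnot'
      exact (nextCollision_eq_some hn).resolve_left fun h => hnot' h.1
  obtain ⟨hhit, rfl⟩ := hstep
  have hhit' : Hits 1 (ctr u ξ v (j + 1)) (orb u ξ v j).1 (orb u ξ v j).2 := by
    rw [hT.eq] at hhit; simpa only [hits_smul_iff hr] using hhit
  obtain ⟨f1, f2, f3⟩ := flight_to_sphere hT.norm_vel hT.outside_succ hhit'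
  have hsph : ‖(orb u ξ v (j + 1)).1 - ctr u ξ v (j + 1)‖ = 1 := f2
  have hvel : ‖(orb u ξ v (j + 1)).2‖ = 1 := by
    rw [← hT.norm_vel]; exact norm_sub_reflection hsph
  refine ⟨?_, ?_, hvel, hsph.ge, ?_, ?_⟩
  · rw [hT.eq, collide_smul hr hT.norm_vel hT.outside_succ hhit', clock_succ, mul_add]
    rfl
  · rw [hasOrbit_iff]
    intro i hi
    rcases Nat.lt_succ_iff_lt_or_eq.1 hi with hi | rfl
    · exact hasOrbit_iff.1 hT.orbit i hi
    · exact ⟨f1, f2, f3⟩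
  -- The balls may overlap, so the new collision point could a priori lie inside the ball just left.
  -- A positive flight ending there would contradict `hnot`; a flight of length zero leaves the
  -- position unchanged.
  · rw [ctr_add_two]
    by_contra! hcon
    rcases f1.eq_or_lt with f0 | f0
    · have : (orb u ξ v (j + 1)).1 = (orb u ξ v j).1 := by
        rw [orb]; simp only [← f0, zero_smul, add_zero]
      rw [this] at hcon
      exact absurd hT.outside (not_le.2 hcon)
    · exact hnot ⟨_, f0, hcon⟩
  · have h1 : inner ℝ (orb u ξ v (j + 1)).2 ((orb u ξ v (j + 1)).1 - ctr u ξ v (j + 1)) =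
        -inner ℝ (orb u ξ v j).2 ((orb u ξ v (j + 1)).1 - ctr u ξ v (j + 1)) := by
      have h2 : (orb u ξ v (j + 1)).2 = (orb u ξ v j).2 -
        (2 * inner ℝ (orb u ξ v j).2 ((orb u ξ v (j + 1)).1 - ctr u ξ v (j + 1))) •
          ((orb u ξ v (j + 1)).1 - ctr u ξ v (j + 1)) := rfl
      rw [h2, inner_sub_left, real_inner_smul_left, real_inner_self_eq_norm_sq, hsph]
      ring
    rw [h1]
    exact neg_nonneg.2 f3

theorem tracks_afterCollision (hr : 0 < r) (hu1 : ‖u‖ = 1) (hv1 : ‖v‖ = 1) (hu : u ≠ e)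
    (huv : u ≠ v) (hh : 0 < h) {j : ℕ} {σ : State} (hσ : afterCollision r u h v (j + 2) = some σ) :
    Tracks r u (h / r) v j σ := by
  induction j generalizing σ with
  | zero =>
    rw [afterCollision] at hσ
    rw [← Option.some.inj hσ]
    exact tracks_zero hr hu1 hv1 hu huv hh
  | succ j ih =>
    rw [afterCollision, Option.bind_eq_some_iff] at hσ
    obtain ⟨σ₀, h1, h2⟩ := hσ
    exact (ih h1).next hr h2

/-! ### Events -/

theorem afterCollision_isSome_of_le {i j : ℕ} (hij : i ≤ j)
    (hj : (afterCollision r u h v j).isSome) : (afterCollision r u h v i).isSome := by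
  induction j, hij using Nat.le_induction with
  | base => exact hj
  | succ j hij ih =>
    rcases j with _ | _ | j
    · exact ih rfl
    · exact ih rfl
    · apply ih
      rw [afterCollision] at hj
      by_contra hc
      rw [Option.not_isSome_iff_eq_none] at hc
      simp [hc] at hj

theorem le_numCollisions {p : S2 × ℝ × S2} {k : ℕ}
    (hk : (afterCollision r p.1 p.2.1 p.2.2 k).isSome) : (k : ℕ∞) ≤ numCollisions r p :=
  le_iSup₂_of_le k hk le_rfl

theorem isSome_of_le_numCollisions {p : S2 × ℝ × S2} {k : ℕ} (hk : (k : ℕ∞) ≤ numCollisions r p) :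
    (afterCollision r p.1 p.2.1 p.2.2 k).isSome := by
  rcases k with _ | k
  · rfl
  by_contra hc
  have h1 : numCollisions r p ≤ (k : ℕ∞) := by
    refine iSup₂_le fun i hi => ?_
    by_contra! hik
    exact hc (afterCollision_isSome_of_le (by exact_mod_cast hik) hi)
  have h2 := hk.trans h1
  norm_cast at h2
  omega

/-- With v = u the particle would continue along u, away from the first ball. -/
theorem ne_of_mem_recollisionSet {p : S2 × ℝ × S2} (hr : 0 < r) (hp : p ∈ recollisionSet r)
    (hu : (p.1 : E3) ≠ e) : (p.1 : E3) ≠ p.2.2 := by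
  obtain ⟨hh, t, ht, hlt⟩ := hp
  intro hc
  rw [← hc] at hlt
  have h1 : p.2.1 • (p.1 : E3) + r • (‖(p.1 : E3) - e‖⁻¹ • ((p.1 : E3) - e)) + t • (p.1 : E3) =
      r • (((p.2.1 + t) / r) • (p.1 : E3) + ‖(p.1 : E3) - e‖⁻¹ • ((p.1 : E3) - e)) := by
    rw [smul_add, smul_smul r ((p.2.1 + t) / r), mul_div_cancel₀ _ hr.ne', add_smul]
    abel
  rw [h1, norm_smul, Real.norm_of_nonneg hr.le, mul_lt_iff_lt_one_right hr] at hlt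
  have h2 := one_le_norm_smul_add (t := (p.2.1 + t) / r)
    (norm_inv_norm_smul (sub_ne_zero.2 hu)) (by positivity)
    (inner_normalize_sub_nonneg (norm_coe_S2 p.1) norm_e)
  linarith

/-- A chord is no longer than its arc. -/
theorem norm_add_le_of_angle_lt {x w : E3} {δ : ℝ} (hx : ‖x‖ = 1) (hw : ‖w‖ = 1)
    (hδ : InnerProductGeometry.angle (-x) w < δ) : ‖w + x‖ ≤ δ := by
  have h0 := InnerProductGeometry.angle_nonneg (-x) w
  have h1 := InnerProductGeometry.cos_angle (-x) w
  rw [norm_neg, hx, hw, inner_neg_left, mul_one, div_one] at h1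
  have h2 := norm_add_sq_real w x
  rw [hx, hw, real_inner_comm] at h2
  have h3 := Real.one_sub_sq_div_two_le_cos (x := InnerProductGeometry.angle (-x) w)
  refine le_trans (le_of_sq_le_sq ?_ h0) hδ.le
  linarith

/-- The initial data for which at least `n` further collisions take place. -/
def orbitSet (n : ℕ) : Set (S2 × ℝ × S2) :=
  {p | (p.1 : E3) ≠ p.2.2 ∧ HasOrbit (p.1 : E3) p.2.1 p.2.2 n}

/-- The initial data for which the velocity is close to `-e` after `n` further collisions. -/
def exitSet (n : ℕ) (δ : ℝ) : Set (S2 × ℝ × S2) :=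
  orbitSet n ∩ {p | ‖(orb (p.1 : E3) p.2.1 p.2.2 n).2 + e‖ ≤ δ}

/-- The initial data for which the `n`-th further collision takes place after time `s`. -/
def lateSet (n : ℕ) (s : ℝ) : Set (S2 × ℝ × S2) :=
  orbitSet n ∩ {p | s < clock p.2.1 (orbTime (p.1 : E3) p.2.1 p.2.2) n}

theorem measurableSet_orbitSet (n : ℕ) : MeasurableSet (orbitSet n) :=
  (measurableSet_eq_fun (f := fun p : S2 × ℝ × S2 => (p.1 : E3)) (g := fun p => (p.2.2 : E3))
    (by fun_prop) (by fun_prop)).compl.inter (measurableSet_hasOrbit n)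

theorem measurableSet_exitSet (n : ℕ) (δ : ℝ) : MeasurableSet (exitSet n δ) :=
  (measurableSet_orbitSet n).inter
    (measurableSet_le ((measurable_orb n).snd.add measurable_const).norm measurable_const)

theorem measurableSet_lateSet (n : ℕ) (s : ℝ) : MeasurableSet (lateSet n s) :=
  (measurableSet_orbitSet n).inter (measurableSet_lt measurable_const (measurable_clock n))

theorem exists_mem_exitSet {p : S2 × ℝ × S2} {δ : ℝ} (hr : 0 < r) (hp : p ∈ recollisionSet r)
    (hu : (p.1 : E3) ≠ e) (hδ : ExitAngleLT r p δ) :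
    ∃ n : ℕ, numCollisions r p = ((n + 2 : ℕ) : ℕ∞) ∧ (p.1, p.2.1 / r, p.2.2) ∈ exitSet n δ := by
  obtain ⟨w, ⟨N, σ, hN, hσ, rfl⟩, hw⟩ := hδ
  have h2 : 2 ≤ N := by
    have : ((2 : ℕ) : ℕ∞) ≤ N := hN ▸ le_numCollisions (p := p) (r := r) (k := 2) rfl
    exact_mod_cast this
  obtain ⟨n, rfl⟩ : ∃ n, N = n + 2 := ⟨N - 2, by omega⟩
  have huv := ne_of_mem_recollisionSet hr hp hu
  have hT := tracks_afterCollision hr (norm_coe_S2 p.1) (norm_coe_S2 p.2.2) hu huv hp.1 hσ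
  refine ⟨n, hN, ⟨huv, hT.orbit⟩, norm_add_le_of_angle_lt norm_e hT.norm_vel ?_⟩
  rwa [hT.eq] at hw

/-- A supremum above r s is exceeded by a single collision time, so N = ∞ needs no separate
treatment. If that collision comes too early, monotonicity of the times moves the index up to k. -/
theorem exists_mem_lateSet {p : S2 × ℝ × S2} {s : ℝ} (hr : 0 < r) (hp : p ∈ recollisionSet r)
    (hu : (p.1 : E3) ≠ e) (hs : ((r * s : ℝ) : EReal) < trappingTime r p) {k : ℕ}
    (hk : ((k + 2 : ℕ) : ℕ∞) ≤ numCollisions r p) :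
    ∃ n : ℕ, k ≤ n ∧ ((n + 2 : ℕ) : ℕ∞) ≤ numCollisions r p ∧
      (p.1, p.2.1 / r, p.2.2) ∈ lateSet n s := by
  have huv := ne_of_mem_recollisionSet hr hp hu
  have hT := fun {j : ℕ} {σ : State} => tracks_afterCollision (j := j) (σ := σ) hr
    (norm_coe_S2 p.1) (norm_coe_S2 p.2.2) hu huv hp.1
  simp only [trappingTime, lt_iSup_iff] at hs
  obtain ⟨i, σ, hσ, hlt⟩ := hs
  have hlt : r * s < σ.time := by exact_mod_cast hlt
  obtain ⟨σk, hσk⟩ := Option.isSome_iff_exists.1 (isSome_of_le_numCollisions hk)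
  have hTk := hT hσk
  by_cases hik : i ≤ k + 2
  · refine ⟨k, le_rfl, hk, ⟨huv, hTk.orbit⟩, ?_⟩
    have h0 : 0 < p.2.1 / r := div_pos hp.1 hr
    have h1 := hTk.orbit.clock_mono (Nat.zero_le k) le_rfl
    rw [clock_zero] at h1
    have h2 : σ.time ≤ r * clock (p.2.1 / r) (orbTime p.1 (p.2.1 / r) p.2.2) k := by
      rcases i with _ | _ | i
      · rw [← Option.some.inj hσ]
        exact mul_nonneg hr.le (h0.le.trans h1)
      · rw [← Option.some.inj hσ]
        exact mul_nonneg hr.le (h0.le.trans h1)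
      · rw [(hT hσ).eq]
        exact mul_le_mul_of_nonneg_left (hTk.orbit.clock_mono (by omega) le_rfl) hr.le
    exact lt_of_mul_lt_mul_left (hlt.trans_le h2) hr.le
  · obtain ⟨n, rfl⟩ : ∃ n, i = n + 2 := ⟨i - 2, by omega⟩
    have hTn := hT hσ
    refine ⟨n, by omega, le_numCollisions (by rw [hσ]; rfl), ⟨huv, hTn.orbit⟩, ?_⟩
    rw [hTn.eq] at hlt
    exact lt_of_mul_lt_mul_left hlt hr.le

end Dynamics

section Slices

variable {u : S2} {ξ δ s : ℝ}

/-! ### Slices at fixed first free flight -/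

theorem uniS2_exit_slice_le (hδ : 0 ≤ δ) :
    uniS2 {v | (u, ξ, v) ∈ ⋃ n, exitSet n δ} ≤ ENNReal.ofReal (2 * δ) := by
  obtain ⟨b, -, hum, hem⟩ := exists_frame (norm_coe_S2 u) e
  refine (measure_mono ?_).trans (uniS2_strip_le b hδ)
  intro v hv
  obtain ⟨n, ⟨-, hv⟩, hw⟩ := Set.mem_iUnion.1 hv
  exact hv.abs_inner_vel_le (b.norm_eq_one 2) hum hem hw (Nat.zero_le n)

/-- On each of the two sides of the last ball the slice has diameter at most ρ, hence measure at
most 2ρ². -/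
theorem uniS2_exit_slice_le_of_far (hu : (u : E3) ≠ e) (hξ : 10 ≤ ξ) {n : ℕ} {ρ : ℝ} (hρ : 0 ≤ ρ)
    (h : ∀ v v' : S2, (u, ξ, v) ∈ exitSet (n + 1) δ → (u, ξ, v') ∈ exitSet (n + 1) δ →
      ‖(orb (u : E3) ξ v n).2 - (orb (u : E3) ξ v' n).2‖ ≤ 45 * δ → ‖(v : E3) - v'‖ ≤ ρ) :
    uniS2 {v | (u, ξ, v) ∈ exitSet (n + 1) δ} ≤ ENNReal.ofReal (4 * ρ ^ 2) := by
  obtain ⟨b, -, hum, hem⟩ := exists_frame (norm_coe_S2 u) e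
  set J : S2 → Prop := fun v => 0 ≤ cross2 (b 0) (b 1)
    ((orb (u : E3) ξ v (n + 1)).1 - ctr u ξ v (n + 1)) (orb (u : E3) ξ v n).2 with hJ
  have key : ∀ v v' : S2, (u, ξ, v) ∈ exitSet (n + 1) δ → (u, ξ, v') ∈ exitSet (n + 1) δ →
      (J v ↔ J v') → ‖(v : E3) - v'‖ ≤ ρ := fun v v' hv hv' hs => h v v' hv hv'
    (hv.1.2.vel_close hv'.1.2 (norm_coe_S2 u) (norm_coe_S2 v) (norm_coe_S2 v') hu hv.1.1 hv'.1.1 hξ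
      hv.2 hv'.2 hum hem hs)
  have h1 : {v | (u, ξ, v) ∈ exitSet (n + 1) δ} ⊆ {v | (u, ξ, v) ∈ exitSet (n + 1) δ ∧ J v} ∪
      {v | (u, ξ, v) ∈ exitSet (n + 1) δ ∧ ¬ J v} := by
    intro v hv
    by_cases hs : J v
    · exact Or.inl ⟨hv, hs⟩
    · exact Or.inr ⟨hv, hs⟩
  refine (measure_mono h1).trans ((measure_union_le _ _).trans ?_)
  have h2 : ENNReal.ofReal (4 * ρ ^ 2) = ENNReal.ofReal (2 * ρ ^ 2) + ENNReal.ofReal (2 * ρ ^ 2) := by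
    rw [← ENNReal.ofReal_add (by positivity) (by positivity)]
    congr 1; ring
  rw [h2]
  gcongr
  · exact uniS2_le_of_dist_le hρ fun v hv v' hv' => key v v' hv.1 hv'.1 (iff_of_true hv.2 hv'.2)
  · exact uniS2_le_of_dist_le hρ fun v hv v' hv' => key v v' hv.1 hv'.1 (iff_of_false hv.2 hv'.2)

theorem uniS2_orbitSet_slice_le (hu : (u : E3) ≠ e) (hξ : 10 ≤ ξ) :
    uniS2 {v | (u, ξ, v) ∈ orbitSet 1} ≤ ENNReal.ofReal (25 / 2 / ξ ^ 2) := by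
  obtain ⟨b, hug, hum, -⟩ := exists_frame (norm_coe_S2 u) e
  have h0 : 0 ≤ 5 / 2 * ξ⁻¹ := by positivity
  refine (measure_mono ?_).trans ((uniS2_box_le b h0 h0).trans
    (ENNReal.ofReal_le_ofReal (le_of_eq ?_)))
  · intro v hv
    have key := fun i => hv.2.abs_inner_vel_zero_le (norm_coe_S2 u) (norm_coe_S2 v) hu hξ one_pos
      (b.norm_eq_one i)
    exact ⟨key 2 hum, key 1 hug⟩
  · field_simp
    norm_num

/-- The last incoming velocity is v itself, giving O(δ²); the return condition gives O(ξ⁻²). The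
bound merges the two, according to which of ξ and 1 + s is larger. -/
theorem uniS2_exit_one_slice_le (hu : (u : E3) ≠ e) (hξ : 10 ≤ ξ) (hs : 0 < s) :
    uniS2 {v | (u, ξ, v) ∈ exitSet 1 (3 / (1 + s))} ≤
      ENNReal.ofReal (300000 / (ξ + (1 + s)) ^ 2) := by
  rcases le_total ξ (1 + s) with h | h
  · refine (uniS2_exit_slice_le_of_far hu hξ (n := 0) (ρ := 45 * (3 / (1 + s))) (by positivity)
      fun v v' _ _ hw => hw).trans (ENNReal.ofReal_le_ofReal ?_)
    have h1 : (ξ + (1 + s)) ^ 2 ≤ (2 * (1 + s)) ^ 2 := by gcongr; linarith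
    calc 4 * (45 * (3 / (1 + s))) ^ 2 = 291600 / (2 * (1 + s)) ^ 2 := by field_simp; norm_num
      _ ≤ 300000 / (ξ + (1 + s)) ^ 2 := by gcongr; norm_num
  · refine (measure_mono fun v hv => hv.1).trans ((uniS2_orbitSet_slice_le hu hξ).trans
      (ENNReal.ofReal_le_ofReal ?_))
    have h1 : (ξ + (1 + s)) ^ 2 ≤ (2 * ξ) ^ 2 := by gcongr; linarith
    calc 25 / 2 / ξ ^ 2 = 50 / (2 * ξ) ^ 2 := by field_simp; norm_num
      _ ≤ 300000 / (ξ + (1 + s)) ^ 2 := by gcongr; norm_num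

theorem uniS2_exit_many_slice_le (hu : (u : E3) ≠ e) (hξ : 10 ≤ ξ) (hs : 0 < s) :
    uniS2 {v | (u, ξ, v) ∈ ⋃ n, exitSet (n + 2) (3 / (1 + s))} ≤
      ENNReal.ofReal (200000 / (1 + s) ^ 2 / (ξ + 0) ^ 2) := by
  have h1 : ∀ n : ℕ, uniS2 {v | (u, ξ, v) ∈ exitSet (n + 2) (3 / (1 + s))} ≤
      ENNReal.ofReal (150000 / (1 + s) ^ 2 / ξ ^ 2 * (1 / 9) ^ n) := by
    intro n
    refine (uniS2_exit_slice_le_of_far hu hξ (n := n + 1)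
      (ρ := 45 * (3 / (1 + s)) / (3 ^ n * (ξ - 3))) ?_ fun v v' hv hv' hw => ?_).trans
      (ENNReal.ofReal_le_ofReal ?_)
    · have : 0 < ξ - 3 := by linarith
      positivity
    · have h2 := (hv.1.2.separation hv'.1.2 (norm_coe_S2 u) (norm_coe_S2 v) (norm_coe_S2 v') hu
        hv.1.1 hv'.1.1 hξ (j := n) (by omega)).2.2
      have : 0 < ξ - 3 := by linarith
      rw [le_div_iff₀ (by positivity)]
      linarith
    · have h3 : (7 / 10 * ξ) ^ 2 ≤ (ξ - 3) ^ 2 := by gcongr; linarith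
      have h4 : 0 < ξ - 3 := by linarith
      have h5 : 0 < ξ := by linarith
      calc 4 * (45 * (3 / (1 + s)) / (3 ^ n * (ξ - 3))) ^ 2
          = 72900 / (1 + s) ^ 2 / (ξ - 3) ^ 2 * (1 / 9) ^ n := by
            rw [div_pow, mul_pow _ (ξ - 3), ← pow_mul, mul_comm n 2, pow_mul, one_div, inv_pow]
            field_simp
            ring
        _ ≤ 72900 / (1 + s) ^ 2 / (7 / 10 * ξ) ^ 2 * (1 / 9) ^ n := by gcongr
        _ = 7290000 / 49 / (1 + s) ^ 2 / ξ ^ 2 * (1 / 9) ^ n := by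
            congr 1
            field_simp
            norm_num
        _ ≤ 150000 / (1 + s) ^ 2 / ξ ^ 2 * (1 / 9) ^ n := by gcongr; norm_num
  have h2 : {v | (u, ξ, v) ∈ ⋃ n, exitSet (n + 2) (3 / (1 + s))} =
      ⋃ n, {v | (u, ξ, v) ∈ exitSet (n + 2) (3 / (1 + s))} := by
    ext v; simp
  have h3 : HasSum (fun n : ℕ => 150000 / (1 + s) ^ 2 / ξ ^ 2 * (1 / 9 : ℝ) ^ n)
      (150000 / (1 + s) ^ 2 / ξ ^ 2 * (1 - 1 / 9)⁻¹) :=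
    (hasSum_geometric_of_lt_one (by norm_num) (by norm_num)).mul_left _
  rw [h2]
  calc uniS2 (⋃ n, {v | (u, ξ, v) ∈ exitSet (n + 2) (3 / (1 + s))})
      ≤ ∑' n, ENNReal.ofReal (150000 / (1 + s) ^ 2 / ξ ^ 2 * (1 / 9) ^ n) :=
        (measure_iUnion_le _).trans (ENNReal.tsum_le_tsum h1)
    _ = ENNReal.ofReal (150000 / (1 + s) ^ 2 / ξ ^ 2 * (1 - 1 / 9)⁻¹) := by
        rw [← ENNReal.ofReal_tsum_of_nonneg (fun n => by positivity) h3.summable, h3.tsum_eq]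
    _ ≤ ENNReal.ofReal (200000 / (1 + s) ^ 2 / (ξ + 0) ^ 2) := by
        apply ENNReal.ofReal_le_ofReal
        rw [add_zero]
        calc 150000 / (1 + s) ^ 2 / ξ ^ 2 * (1 - 1 / 9)⁻¹ = 168750 / (1 + s) ^ 2 / ξ ^ 2 := by ring
          _ ≤ 200000 / (1 + s) ^ 2 / ξ ^ 2 := by gcongr; norm_num

theorem uniS2_late_one_slice_le (hu : (u : E3) ≠ e) (hξ : 0 < ξ) (hs : 0 < s) :
    uniS2 {v | (u, ξ, v) ∈ lateSet 1 s} ≤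
      ENNReal.ofReal (if ξ < 10 then 25 / (1 + s) else 1225 / (ξ + (1 + s)) ^ 2) := by
  -- The collision happens by time 2ξ + 4. In the first case 1 + s < 25 if ξ < 10, and ξ + 1 + s ≤
  -- 7ξ/2 otherwise.
  by_cases hsξ : s < 2 * ξ + 4
  · split_ifs with h
    · refine prob_le_one.trans ?_
      rw [← ENNReal.ofReal_one]
      apply ENNReal.ofReal_le_ofReal
      rw [one_le_div (by positivity)]
      linarith
    · refine (measure_mono fun v hv => hv.1).trans ((uniS2_orbitSet_slice_le hu (not_lt.1 h)).trans
        (ENNReal.ofReal_le_ofReal ?_))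
      have h1 : (ξ + (1 + s)) ^ 2 ≤ (7 / 2 * ξ) ^ 2 := by gcongr; linarith
      calc 25 / 2 / ξ ^ 2 = 1225 / 8 / (7 / 2 * ξ) ^ 2 := by field_simp; norm_num
        _ ≤ 1225 / (ξ + (1 + s)) ^ 2 := by gcongr; norm_num
  · have : {v | (u, ξ, v) ∈ lateSet 1 s} = ∅ := by
      ext v
      simp only [Set.mem_empty_iff_false, iff_false]
      intro hv
      have h1 := hv.1.2.clock_one_le (norm_coe_S2 u) (norm_coe_S2 v) hu hv.1.1 hξ one_pos
      exact hsξ (lt_of_lt_of_le hv.2 h1)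
    rw [this, measure_empty]
    exact zero_le

theorem uniS2_late_many_slice_le (hu : (u : E3) ≠ e) (hξ : 0 < ξ) (hs : 0 < s) :
    uniS2 {v | (u, ξ, v) ∈ ⋃ n, lateSet (n + 2) s} ≤
      ENNReal.ofReal (if ξ < 10 then 8000000 / (1 + s ^ 2) else
        12500000 * ξ / (ξ ^ 2 + s ^ 2) ^ 2) := by
  obtain ⟨b, hug, hum, hem⟩ := exists_frame (norm_coe_S2 u) e
  split_ifs with h
  · refine (measure_mono ?_).trans ((uniS2_strip_le b (α := 4000000 / (1 + s ^ 2))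
      (by positivity)).trans (ENNReal.ofReal_le_ofReal (by rw [mul_div_assoc']; norm_num)))
    intro v hv
    obtain ⟨n, hv, hlt⟩ := Set.mem_iUnion.1 hv
    exact hv.2.abs_inner_le_of_trapped_near (norm_coe_S2 u) (norm_coe_S2 v) hu hv.1 hξ h.le
      (b.norm_eq_one 2) hum hem hs (le_of_lt hlt)
  · refine (measure_mono ?_).trans ((uniS2_box_le b (α := 2500000 * ξ ^ 2 / (ξ + s) ^ 4)
      (β := 5 / 2 * ξ⁻¹) (by positivity) (by positivity)).trans (ENNReal.ofReal_le_ofReal ?_))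
    · intro v hv
      obtain ⟨n, hv, hlt⟩ := Set.mem_iUnion.1 hv
      exact ⟨hv.2.abs_inner_le_of_trapped_far (norm_coe_S2 u) (norm_coe_S2 v) hu hv.1 (not_lt.1 h)
        (by omega) (b.norm_eq_one 2) hum hem hs (le_of_lt hlt),
        hv.2.abs_inner_vel_zero_le (norm_coe_S2 u) (norm_coe_S2 v) hu (not_lt.1 h) (by omega)
        (b.norm_eq_one 1) hug⟩
    · have h1 : (ξ ^ 2 + s ^ 2) ^ 2 ≤ (ξ + s) ^ 4 := by
        calc (ξ ^ 2 + s ^ 2) ^ 2 ≤ ((ξ + s) ^ 2) ^ 2 := by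
              gcongr; nlinarith [mul_pos hξ hs]
          _ = (ξ + s) ^ 4 := by ring
      calc 2 * (2500000 * ξ ^ 2 / (ξ + s) ^ 4) * (5 / 2 * ξ⁻¹)
          = 12500000 * ξ / (ξ + s) ^ 4 := by field_simp; norm_num
        _ ≤ 12500000 * ξ / (ξ ^ 2 + s ^ 2) ^ 2 := by gcongr

end Slices

/-! ### Integration over the free flight -/

theorem lintegral_ite_le {f F : ℝ → ℝ} {M K : ℝ} (hM : 0 ≤ M)
    (hF : ∀ x, 10 ≤ x → HasDerivAt F (f x) x) (hf : ∀ x, 10 ≤ x → 0 ≤ f x)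
    (hlim : Filter.Tendsto F Filter.atTop (nhds 0)) (hK : 10 * M - F 10 ≤ K) :
    ∫⁻ x in Set.Ioi 0, ENNReal.ofReal (if x < 10 then M else f x) ≤ ENNReal.ofReal K := by
  have h1 : ∫⁻ x in Set.Ioo 0 10, ENNReal.ofReal (if x < 10 then M else f x) =
      ENNReal.ofReal (10 * M) := by
    rw [setLIntegral_congr_fun (g := fun _ => ENNReal.ofReal M) measurableSet_Ioo
      (fun x hx => by simp only [if_pos hx.2]), setLIntegral_const, Real.volume_Ioo,
      ← ENNReal.ofReal_mul hM]
    congr 1; ring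
  have h2 : ∫⁻ x in Set.Ici 10, ENNReal.ofReal (if x < 10 then M else f x) =
      ENNReal.ofReal (-F 10) := by
    rw [setLIntegral_congr_fun (g := fun x => ENNReal.ofReal (f x)) measurableSet_Ici
      (fun x hx => by simp only [if_neg (not_lt.2 (Set.mem_Ici.1 hx))]), setLIntegral_congr Ioi_ae_eq_Ici.symm,
      ← ofReal_integral_eq_lintegral_ofReal, integral_Ioi_of_hasDerivAt_of_nonneg'
        (fun x hx => hF x hx) (fun x hx => hf x (le_of_lt hx)) hlim, zero_sub]
    · exact integrableOn_Ioi_deriv_of_nonneg' (fun x hx => hF x hx)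
        (fun x hx => hf x (le_of_lt hx)) hlim
    · exact ae_restrict_of_forall_mem measurableSet_Ioi fun x hx => hf x (le_of_lt hx)
  have h3 : F 10 ≤ 0 := by
    have hmono : MonotoneOn F (Set.Ici 10) := monotoneOn_of_hasDerivWithinAt_nonneg
      (convex_Ici 10) (fun x hx => (hF x hx).continuousAt.continuousWithinAt)
      (fun x hx => (hF x (interior_subset hx)).hasDerivWithinAt)
      (fun x hx => hf x (interior_subset hx))
    refine ge_of_tendsto hlim ?_
    filter_upwards [Filter.eventually_ge_atTop 10] with x hx
    exact hmono (Set.mem_Ici.2 le_rfl) hx hx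
  rw [← Set.Ioo_union_Ici_eq_Ioi (show (0 : ℝ) < 10 by norm_num)]
  refine (lintegral_union_le _ _ _).trans ?_
  rw [h1, h2, ← ENNReal.ofReal_add (by positivity) (by linarith)]
  exact ENNReal.ofReal_le_ofReal (by linarith)

theorem lintegral_inv_sq_le {M c b K : ℝ} (hM : 0 ≤ M) (hc : 0 ≤ c) (hb : 0 ≤ b)
    (hK : 10 * M + c / (10 + b) ≤ K) :
    ∫⁻ x in Set.Ioi 0, ENNReal.ofReal (if x < 10 then M else c / (x + b) ^ 2) ≤
      ENNReal.ofReal K := by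
  refine lintegral_ite_le (F := fun x => -(c / (x + b))) hM (fun x hx => ?_)
    (fun x hx => by positivity) ?_ (by simpa using hK)
  · have hx' : x + b ≠ 0 := by linarith
    have := (((hasDerivAt_id x).add_const b).inv hx').const_mul (-c)
    refine (this.congr_deriv ?_).congr_of_eventuallyEq (Filter.Eventually.of_forall fun y => ?_)
    · simp only [id]; field_simp
    · simp only [id, Pi.inv_apply]; ring
  · have h1 : Filter.Tendsto (fun x : ℝ => x + b) Filter.atTop Filter.atTop :=
      Filter.tendsto_atTop_add_const_right _ b Filter.tendsto_id
    simpa using (h1.const_div_atTop c).neg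

theorem lintegral_div_sq_add_sq_le {M c s K : ℝ} (hM : 0 ≤ M) (hc : 0 ≤ c)
    (hK : 10 * M + c / 2 / (10 ^ 2 + s ^ 2) ≤ K) :
    ∫⁻ x in Set.Ioi 0, ENNReal.ofReal (if x < 10 then M else c * x / (x ^ 2 + s ^ 2) ^ 2) ≤
      ENNReal.ofReal K := by
  refine lintegral_ite_le (F := fun x => -(c / 2 / (x ^ 2 + s ^ 2))) hM (fun x hx => ?_)
    (fun x hx => ?_) ?_ (by simpa using hK)
  · have hx0 : 0 < x := by linarith
    have hx' : x ^ 2 + s ^ 2 ≠ 0 := by positivity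
    have := ((((hasDerivAt_id x).pow 2).add_const (s ^ 2)).inv hx').const_mul (-(c / 2))
    refine (this.congr_deriv ?_).congr_of_eventuallyEq (Filter.Eventually.of_forall fun y => ?_)
    · simp only [id, Pi.pow_apply]; field_simp; norm_num
    · simp only [id, Pi.inv_apply, Pi.pow_apply]; ring
  · have hx0 : 0 < x := by linarith
    positivity
  · have h1 : Filter.Tendsto (fun x : ℝ => x ^ 2 + s ^ 2) Filter.atTop Filter.atTop :=
      Filter.tendsto_atTop_add_const_right _ _ (Filter.tendsto_pow_atTop two_ne_zero)
    simpa using (h1.const_div_atTop (c / 2)).neg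

/-! ### The five measure estimates -/

section Estimates

variable {r s : ℝ}

/-- Since |w + e| ≤ 2 always, |w + e|(1 + s) ≤ 2 + 1; this replaces s⁻¹ by a bound that stays finite
as s → 0. -/
theorem exitSet_inv_subset (hs : 0 < s) (n : ℕ) : exitSet n s⁻¹ ⊆ exitSet n (3 / (1 + s)) := by
  rintro p ⟨hp, hw⟩
  refine ⟨hp, ?_⟩
  have hw : ‖(orb (p.1 : E3) p.2.1 p.2.2 n).2 + e‖ ≤ s⁻¹ := hw
  show ‖(orb (p.1 : E3) p.2.1 p.2.2 n).2 + e‖ ≤ 3 / (1 + s)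
  have h1 := norm_add_le (orb (p.1 : E3) p.2.1 p.2.2 n).2 e
  have h2 : ‖(orb (p.1 : E3) p.2.1 p.2.2 n).2‖ = 1 := hp.2.norm_vel (norm_coe_S2 _) le_rfl
  rw [h2, norm_e] at h1
  rw [le_div_iff₀ (by positivity)]
  rw [← one_div, le_div_iff₀ hs] at hw
  linarith

theorem measurable_ite_lt {f : ℝ → ℝ} (hf : Measurable f) (M : ℝ) :
    Measurable fun x : ℝ => if x < 10 then M else f x :=
  Measurable.ite measurableSet_Iio measurable_const hf

theorem mu_exit_near_le (hr : 0 < r) (hs : 0 < s) :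
    mu {p | p ∈ recollisionSet r ∧ ExitAngleLT r p s⁻¹ ∧ p.2.1 ≤ 10 * r} ≤
      ENNReal.ofReal (2 * r * (120 / (1 + s))) := by
  refine mu_le_of_slices hr (G := (⋃ n, exitSet n (3 / (1 + s))) ∩ {p | p.2.1 ≤ 10})
    ((MeasurableSet.iUnion fun n => measurableSet_exitSet n _).inter
      (measurableSet_le (by fun_prop) measurable_const))
    -- The second branch matters only at ξ = 10, where 600/10² = 6.
    (g := fun x => if x < 10 then 6 / (1 + s) else 600 / (1 + s) / (x + 0) ^ 2)
    (measurable_ite_lt (by fun_prop) _) ?_ ?_ ?_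
  · rintro p ⟨hp, hw, hh⟩ hu
    obtain ⟨n, -, hn⟩ := exists_mem_exitSet hr hp hu hw
    exact ⟨hp.1, Set.mem_iUnion.2 ⟨n, exitSet_inv_subset hs n hn⟩, (div_le_iff₀ hr).2 hh⟩
  · intro u hu ξ hξ
    by_cases h10 : ξ ≤ 10
    · refine (measure_mono fun v hv => hv.1).trans ((uniS2_exit_slice_le (by positivity)).trans
        (ENNReal.ofReal_le_ofReal ?_))
      split_ifs with h
      · exact le_of_eq (by ring)
      · rw [le_antisymm h10 (not_lt.1 h)]
        exact le_of_eq (by ring)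
    · have : {v | (u, ξ, v) ∈ (⋃ n, exitSet n (3 / (1 + s))) ∩ {p | p.2.1 ≤ 10}} = ∅ := by
        ext v
        simp only [Set.mem_empty_iff_false, iff_false]
        exact fun hv => h10 hv.2
      rw [this, measure_empty]
      exact zero_le
  · refine lintegral_inv_sq_le (by positivity) (by positivity) le_rfl (le_of_eq ?_)
    field_simp
    norm_num

theorem mu_le_of_far_slices {K c b : ℝ} (hr : 0 < r) (hc : 0 ≤ c) (hb : 0 ≤ b)
    {S : Set (S2 × ℝ × S2)} {G : Set (S2 × ℝ × S2)} (hG : MeasurableSet G)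
    (hS : ∀ p ∈ S, (p.1 : E3) ≠ e → 0 < p.2.1 ∧ 10 * r ≤ p.2.1 ∧ (p.1, p.2.1 / r, p.2.2) ∈ G)
    (hslice : ∀ u : S2, (u : E3) ≠ e → ∀ ξ : ℝ, 10 ≤ ξ →
      uniS2 {v | (u, ξ, v) ∈ G} ≤ ENNReal.ofReal (c / (ξ + b) ^ 2))
    (hK : c / (10 + b) ≤ K) : mu S ≤ ENNReal.ofReal (2 * r * K) := by
  refine mu_le_of_slices hr (G := G ∩ {p | 10 ≤ p.2.1})
    (hG.inter (measurableSet_le measurable_const (by fun_prop)))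
    (g := fun x => if x < 10 then 0 else c / (x + b) ^ 2)
    (measurable_ite_lt (by fun_prop) _) ?_ ?_ (lintegral_inv_sq_le le_rfl hc hb (by linarith))
  · intro p hp hu
    obtain ⟨h1, h2, h3⟩ := hS p hp hu
    exact ⟨h1, h3, (le_div_iff₀ hr).2 h2⟩
  · intro u hu ξ hξ
    split_ifs with h
    · have : {v | (u, ξ, v) ∈ G ∩ {p | 10 ≤ p.2.1}} = ∅ := by
        ext v
        simp only [Set.mem_empty_iff_false, iff_false]
        exact fun hv => not_le.2 h hv.2
      rw [this, measure_empty]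
      exact zero_le
    · exact (measure_mono fun v hv => hv.1).trans (hslice u hu ξ (not_lt.1 h))

theorem mu_exit_three_le (hr : 0 < r) (hs : 0 < s) :
    mu {p | p ∈ recollisionSet r ∧ ExitAngleLT r p s⁻¹ ∧ 10 * r ≤ p.2.1 ∧
      numCollisions r p = 3} ≤ ENNReal.ofReal (2 * r * (300000 / (1 + s))) := by
  refine mu_le_of_far_slices hr (by norm_num) (by positivity) (measurableSet_exitSet 1 _) ?_
    (fun u hu ξ hξ => uniS2_exit_one_slice_le hu hξ hs) ?_
  · rintro p ⟨hp, hw, hh, hN⟩ hu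
    obtain ⟨n, hn, hmem⟩ := exists_mem_exitSet hr hp hu hw
    rw [hN] at hn
    have : n = 1 := by
      have : 3 = n + 2 := by exact_mod_cast hn
      omega
    subst this
    exact ⟨hp.1, hh, exitSet_inv_subset hs 1 hmem⟩
  · exact div_le_div_of_nonneg_left (by norm_num) (by positivity) (by linarith)

theorem mu_exit_many_le (hr : 0 < r) (hs : 0 < s) :
    mu {p | p ∈ recollisionSet r ∧ ExitAngleLT r p s⁻¹ ∧ 10 * r ≤ p.2.1 ∧
      4 ≤ numCollisions r p} ≤ ENNReal.ofReal (2 * r * (20000 / (1 + s) ^ 2)) := by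
  refine mu_le_of_far_slices hr (c := 200000 / (1 + s) ^ 2) (by positivity) le_rfl
    (MeasurableSet.iUnion fun n => measurableSet_exitSet (n + 2) _) ?_
    (fun u hu ξ hξ => uniS2_exit_many_slice_le hu hξ hs) ?_
  · rintro p ⟨hp, hw, hh, hN⟩ hu
    obtain ⟨n, hn, hmem⟩ := exists_mem_exitSet hr hp hu hw
    rw [hn] at hN
    obtain ⟨k, rfl⟩ : ∃ k, n = k + 2 := by
      have : 4 ≤ n + 2 := by exact_mod_cast hN
      exact ⟨n - 2, by omega⟩
    exact ⟨hp.1, hh, Set.mem_iUnion.2 ⟨k, exitSet_inv_subset hs _ hmem⟩⟩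
  · refine le_of_eq ?_
    field_simp
    norm_num

theorem mu_late_three_le (hr : 0 < r) (hs : 0 < s) :
    mu {p | p ∈ recollisionSet r ∧ ((r * s : ℝ) : EReal) < trappingTime r p ∧
      numCollisions r p = 3} ≤ ENNReal.ofReal (2 * r * (1500 / (1 + s))) := by
  refine mu_le_of_slices hr (measurableSet_lateSet 1 s) (measurable_ite_lt (by fun_prop) _) ?_
    (fun u hu ξ hξ => uniS2_late_one_slice_le hu hξ hs)
    (lintegral_inv_sq_le (by positivity) (by norm_num) (by positivity) ?_)
  · rintro p ⟨hp, hlt, hN⟩ hu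
    obtain ⟨n, h1, h2, hmem⟩ := exists_mem_lateSet hr hp hu hlt (k := 1) (by rw [hN]; rfl)
    rw [hN] at h2
    have : n = 1 := by
      have : n + 2 ≤ 3 := by exact_mod_cast h2
      omega
    subst this
    exact ⟨hp.1, hmem⟩
  · have h1 : 1225 / (10 + (1 + s)) ≤ 1225 / (1 + s) :=
      div_le_div_of_nonneg_left (by norm_num) (by positivity) (by linarith)
    calc 10 * (25 / (1 + s)) + 1225 / (10 + (1 + s)) ≤ 250 / (1 + s) + 1225 / (1 + s) := by
          rw [mul_div_assoc']; norm_num; linarith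
      _ = 1475 / (1 + s) := by rw [← add_div]; norm_num
      _ ≤ 1500 / (1 + s) := by gcongr; norm_num

theorem mu_late_many_le (hr : 0 < r) (hs : 0 < s) :
    mu {p | p ∈ recollisionSet r ∧ ((r * s : ℝ) : EReal) < trappingTime r p ∧
      4 ≤ numCollisions r p} ≤ ENNReal.ofReal (2 * r * (100000000 / (1 + s ^ 2))) := by
  refine mu_le_of_slices hr (MeasurableSet.iUnion fun n => measurableSet_lateSet (n + 2) s)
    (measurable_ite_lt (by fun_prop) _) ?_
    (fun u hu ξ hξ => uniS2_late_many_slice_le hu hξ hs)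
    (lintegral_div_sq_add_sq_le (by positivity) (by norm_num) ?_)
  · rintro p ⟨hp, hlt, hN⟩ hu
    obtain ⟨n, h1, h2, hmem⟩ := exists_mem_lateSet hr hp hu hlt (k := 2) (by exact_mod_cast hN)
    obtain ⟨k, rfl⟩ : ∃ k, n = k + 2 := ⟨n - 2, by omega⟩
    exact ⟨hp.1, Set.mem_iUnion.2 ⟨k, hmem⟩⟩
  · have h1 : 12500000 / 2 / (10 ^ 2 + s ^ 2) ≤ 12500000 / 2 / (1 + s ^ 2) := by gcongr; norm_num
    calc 10 * (8000000 / (1 + s ^ 2)) + 12500000 / 2 / (10 ^ 2 + s ^ 2)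
        ≤ 80000000 / (1 + s ^ 2) + 12500000 / 2 / (1 + s ^ 2) := by
          rw [mul_div_assoc' 10]; norm_num at h1 ⊢; linarith
      _ = 86250000 / (1 + s ^ 2) := by rw [← add_div]; norm_num
      _ ≤ 100000000 / (1 + s ^ 2) := by gcongr; norm_num

theorem ofReal_bound_le {K C d : ℝ} (hr : 0 < r) (hd : 0 < d) (hK : 2 * K ≤ C) :
    ENNReal.ofReal (2 * r * (K / d)) ≤ ENNReal.ofReal (C * r / d) := by
  apply ENNReal.ofReal_le_ofReal
  rw [mul_div_assoc']
  exact div_le_div_of_nonneg_right (by nlinarith) hd.le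

end Estimates

end Lorentz

open Lorentz in
theorem mainTheorem3 :
    ∃ C : ℝ, 0 < C ∧
      (∀ r s : ℝ, 0 < r → 0 < s →
        mu {p | p ∈ recollisionSet r ∧ ExitAngleLT r p s⁻¹ ∧ p.2.1 ≤ 10 * r}
            ≤ ENNReal.ofReal (C * r / (1 + s)) ∧
        mu {p | p ∈ recollisionSet r ∧ ExitAngleLT r p s⁻¹ ∧ 10 * r ≤ p.2.1 ∧
              numCollisions r p = 3}
            ≤ ENNReal.ofReal (C * r / (1 + s)) ∧
        mu {p | p ∈ recollisionSet r ∧ ExitAngleLT r p s⁻¹ ∧ 10 * r ≤ p.2.1 ∧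
              4 ≤ numCollisions r p}
            ≤ ENNReal.ofReal (C * r / (1 + s) ^ 2) ∧
        mu {p | p ∈ recollisionSet r ∧ ((r * s : ℝ) : EReal) < trappingTime r p ∧
              numCollisions r p = 3}
            ≤ ENNReal.ofReal (C * r / (1 + s)) ∧
        mu {p | p ∈ recollisionSet r ∧ ((r * s : ℝ) : EReal) < trappingTime r p ∧
              4 ≤ numCollisions r p}
            ≤ ENNReal.ofReal (C * r / (1 + s ^ 2))) ∧
      (∀ r s : ℝ, 0 < r → r ≤ 1 → 0 < s →
        mu {p | p ∈ recollisionSet r ∧ ((s : ℝ) : EReal) < trappingTime r p ∧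
              numCollisions r p = 3}
            ≤ ENNReal.ofReal (C * r / (1 + s)) ∧
        mu {p | p ∈ recollisionSet r ∧ ((s : ℝ) : EReal) < trappingTime r p ∧
              4 ≤ numCollisions r p}
            ≤ ENNReal.ofReal (C * r / (1 + s ^ 2))) := by
  -- Twice the largest constant K, the one in `mu_late_many_le`.
  refine ⟨200000000, by norm_num, fun r s hr hs => ⟨?_, ?_, ?_, ?_, ?_⟩,
    fun r s hr hr1 hs => ?_⟩
  · exact (mu_exit_near_le hr hs).trans (ofReal_bound_le hr (by positivity) (by norm_num))
  · exact (mu_exit_three_le hr hs).trans (ofReal_bound_le hr (by positivity) (by norm_num))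
  · exact (mu_exit_many_le hr hs).trans (ofReal_bound_le hr (by positivity) (by norm_num))
  · exact (mu_late_three_le hr hs).trans (ofReal_bound_le hr (by positivity) (by norm_num))
  · exact (mu_late_many_le hr hs).trans (ofReal_bound_le hr (by positivity) (by norm_num))
  -- The unscaled bounds are the scaled ones at s/r, which is at least s because r ≤ 1.
  · have hsr : s ≤ s / r := le_div_self hs.le hr hr1
    have h1 := mu_late_three_le hr (div_pos hs hr)
    have h2 := mu_late_many_le hr (div_pos hs hr)
    rw [mul_div_cancel₀ _ hr.ne'] at h1 h2
    constructor
    · refine h1.trans (le_trans (ENNReal.ofReal_le_ofReal ?_)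
        (ofReal_bound_le (K := 1500) hr (by positivity) (by norm_num)))
      gcongr
    · refine h2.trans (le_trans (ENNReal.ofReal_le_ofReal ?_)
        (ofReal_bound_le (K := 100000000) hr (by positivity) (by norm_num)))
      gcongr
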